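/- **Theorem (classical approximation of fluxon link invariants).** Let $G$ be a finite group, $g\in G$, and let $C$ be the conjugacy class of $g$, $d=|C|$. Let $\mathsf D(G)$ be the quantum double of $G$, with basis $kh^*$ ($k,h\in G$), product $(g_1h_1^*)(g_2h_2^*)=\delta_{g_2^{-1}h_1g_2,\,h_2}\,g_1g_2h_2^*$ and $R$-matrix $R=\sum_{k} k\otimes k^*$, where $k$ stands for $\sum_h kh^*$ and $k^*$ for $ek^*$. The *fluxon irrep* $\Lambda=([g],\text{trivial})$ is the space $V_\Lambda$ with orthonormal basis $\{|x\rangle : x\in C\}$ and action $kh^*|x\rangle=\delta_{h,x}|kxk^{-1}\rangle$. Let $\tau_\Lambda$ be the representation of the braid group $B_n$ on $V_\Lambda^{\otimes n}$ in which $\sigma_i$ acts as $TR$ on the tensor factors $i,i+1$ ($T$ exchanges the two factors). For $b\in B_n$, $n\ge 1$, the trace closure is $L_\Lambda(b)=d^{-1}\operatorname{tr}\tau_\Lambda(b)$. If $C=C^{-1}$ and $b\in B_{2l}$, the plat closure is $\mathrm{Pl}_\Lambda(b)=\langle\alpha|\tau_\Lambda(b)|\alpha\rangle$ with $|\alpha\rangle=|\Phi\rangle^{\otimes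 l}$, $|\Phi\rangle=d^{-1/2}\sum_{x\in C}|x\rangle\otimes|x^{-1}\rangle$. Then for every braid $b\in B_n$ the operator $\tau_\Lambda(b)$ is a permutation matrix in the basis $\{|x_1\rangle\otimes\dots\otimes|x_n\rangle: x_i\in C\}$. Moreover, consider classical random access machines with logarithmic cost and fair coin tosses, for which the elements of $G$ are labelled in an arbitrary way by $0,\dots,|G|-1$ and the multiplication and inversion tables of $G$ in this labelling can be looked up by random access. The input consists of $|G|$, the label of $g$, the number $n$ of strands, a word of length $m$ in the generators $\sigma_i^{\pm1}$ that spells $b$, and, in (2) and (3), the number $\lceil 1/\epsilon\rceil$, where $\epsilon>0$. There are machines, one for each item and independent of $G$, of the labelling, of $g$ and of all other data, such that: 1. given also the labels of $x_1,\dots,x_n,y_1,\dots,y_n\in C$, the first machine computes, without coin tosses, the matrix entry $\langle y_1,\dots,y_n|\tau_\Lambda(b)|x_1,\dots,x_n\rangle$ in time $\mathrm{poly}(m,n,\log|G|)$; 2. for $n\ge1$, the second machine always halts within time $\mathrm{poly}(m,n,\log|G|,1/\epsilon)$ and outputs a rational number $q$ with $\Pr\bigl[\,|L_\Lambda(b)-d^{\,n-1}q|>\epsilon\,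 d^{\,n-1}\bigr]<\tfrac14$ (an additive approximation of the trace closure with normalization $d^{\,n-1}$, i.e. of $d^{-n}\operatorname{tr}\tau_\Lambda(b)$ to within $\epsilon$); 3. for $n=2l$ and $C=C^{-1}$, the third machine always halts within time $\mathrm{poly}(m,n,\log|G|,1/\epsilon)$ and outputs a rational number $q$ with $\Pr\bigl[\,|\mathrm{Pl}_\Lambda(b)-q|>\epsilon\bigr]<\tfrac14$. The polynomials are fixed and do not depend on the input. -/

import Mathlib

universe u

/-! ### The quantum double of a finite group -/

/-- The vector space `ℂ[G] ⊗ ℂG` underlying `D(G)`: `a` stands for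
`∑ g h, a.coeff g h • g h^*`. -/
@[ext] structure QuantumDouble (G : Type u) : Type u where
  /-- the coefficient of `g h^*` -/
  coeff : G → G → ℂ

namespace QuantumDouble

section Linear

variable {G : Type u}

instance : Zero (QuantumDouble G) := ⟨⟨fun _ _ => 0⟩⟩

noncomputable instance : Add (QuantumDouble G) :=
  ⟨fun a b => ⟨fun g h => a.coeff g h + b.coeff g h⟩⟩

noncomputable instance : Neg (QuantumDouble G) := ⟨fun a => ⟨fun g h => - a.coeff g h⟩⟩

noncomputable instance : SMul ℂ (QuantumDouble G) := ⟨fun c a => ⟨fun g h => c * a.coeff g h⟩⟩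

@[simp] theorem coeff_zero (g h : G) : (0 : QuantumDouble G).coeff g h = 0 := rfl

@[simp] theorem coeff_add (a b : QuantumDouble G) (g h : G) :
    (a + b).coeff g h = a.coeff g h + b.coeff g h := rfl

@[simp] theorem coeff_neg (a : QuantumDouble G) (g h : G) :
    (-a).coeff g h = - a.coeff g h := rfl

@[simp] theorem coeff_smul (c : ℂ) (a : QuantumDouble G) (g h : G) :
    (c • a).coeff g h = c * a.coeff g h := rfl

theorem ext_coeff {a b : QuantumDouble G} (h : ∀ x y, a.coeff x y = b.coeff x y) : a = b :=
  QuantumDouble.ext (funext fun x => funext fun y => h x y)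

noncomputable instance : AddCommGroup (QuantumDouble G) where
  add_assoc a b c := ext_coeff fun g h => by simp [add_assoc]
  zero_add a := ext_coeff fun g h => by simp
  add_zero a := ext_coeff fun g h => by simp
  add_comm a b := ext_coeff fun g h => by simp [add_comm]
  neg_add_cancel a := ext_coeff fun g h => by simp
  nsmul := nsmulRec
  zsmul := zsmulRec

noncomputable instance : Module ℂ (QuantumDouble G) where
  one_smul a := ext_coeff fun g h => by simp
  mul_smul c d a := ext_coeff fun g h => by simp [mul_assoc]
  smul_zero c := ext_coeff fun g h => by simp
  smul_add c a b := ext_coeff fun g h => by simp [mul_add]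
  add_smul c d a := ext_coeff fun g h => by simp [add_mul]
  zero_smul a := ext_coeff fun g h => by simp

end Linear

section Ring

variable {G : Type u} [Group G]

open Classical in
/-- The unit `∑ h, e h^*`. -/
noncomputable instance : One (QuantumDouble G) :=
  ⟨⟨fun g _ => if g = 1 then 1 else 0⟩⟩

open Classical in
theorem coeff_one (g h : G) :
    (1 : QuantumDouble G).coeff g h = if g = 1 then 1 else 0 := rfl

variable [Fintype G]

/-- The bilinear extension of `(g₁ h₁^*)(g₂ h₂^*) = δ_{g₂⁻¹ h₁ g₂, h₂} g₁ g₂ h₂^*`. -/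
noncomputable instance : Mul (QuantumDouble G) :=
  ⟨fun a b => ⟨fun g h => ∑ y : G, a.coeff (g * y⁻¹) (y * h * y⁻¹) * b.coeff y h⟩⟩

theorem coeff_mul (a b : QuantumDouble G) (g h : G) :
    (a * b).coeff g h = ∑ y : G, a.coeff (g * y⁻¹) (y * h * y⁻¹) * b.coeff y h := rfl

noncomputable instance : Ring (QuantumDouble G) where
  left_distrib a b c := ext_coeff fun g h => by
    simp only [coeff_mul, coeff_add, mul_add, Finset.sum_add_distrib]
  right_distrib a b c := ext_coeff fun g h => by
    simp only [coeff_mul, coeff_add, add_mul, Finset.sum_add_distrib]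
  zero_mul a := ext_coeff fun g h => by
    simp only [coeff_mul, coeff_zero, zero_mul, Finset.sum_const_zero]
  mul_zero a := ext_coeff fun g h => by
    simp only [coeff_mul, coeff_zero, mul_zero, Finset.sum_const_zero]
  mul_assoc a b c := ext_coeff fun g h => by
    simp only [coeff_mul, Finset.sum_mul, Finset.mul_sum]
    conv_rhs => rw [Finset.sum_comm]
    refine Finset.sum_congr rfl fun z _ => ?_
    rw [← Equiv.sum_comp (Equiv.mulRight z) (fun y => a.coeff (g * y⁻¹) (y * h * y⁻¹) *
      (b.coeff (y * z⁻¹) (z * h * z⁻¹) * c.coeff z h))]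
    refine Finset.sum_congr rfl fun y _ => ?_
    simp only [Equiv.coe_mulRight, mul_inv_rev, mul_assoc, mul_inv_cancel, mul_one]
  one_mul a := ext_coeff fun g h => by
    rw [coeff_mul, Finset.sum_eq_single g]
    · simp [coeff_one]
    · intro y _ hy
      rw [coeff_one, if_neg (fun h => hy (mul_inv_eq_one.1 h).symm), zero_mul]
    · simp
  mul_one a := ext_coeff fun g h => by
    rw [coeff_mul, Finset.sum_eq_single 1]
    · simp [coeff_one]
    · intro y _ hy
      rw [coeff_one, if_neg hy, mul_zero]
    · simp
  zsmul := zsmulRec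
  neg_add_cancel := neg_add_cancel

noncomputable instance : Algebra ℂ (QuantumDouble G) :=
  Algebra.ofModule
    (fun c a b => ext_coeff fun g h => by
      simp only [coeff_mul, coeff_smul, Finset.mul_sum, mul_assoc])
    (fun c a b => ext_coeff fun g h => by
      simp only [coeff_mul, coeff_smul, Finset.mul_sum, mul_left_comm])

end Ring

variable {G : Type u} [Group G]

open Classical in
/-- The image `∑ h, k h^*` of the group element `k` in `D(G)`. -/
noncomputable def ofGroup (k : G) : QuantumDouble G := ⟨fun x _ => if x = k then 1 else 0⟩

open Classical in
/-- The element `e k^*` of `D(G)`. -/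
noncomputable def ofDual (k : G) : QuantumDouble G :=
  ⟨fun x y => if x = 1 ∧ y = k then 1 else 0⟩

open TensorProduct in
/-- The universal `R`-matrix `∑ k, k ⊗ k^*`. -/
noncomputable def rMatrix (G : Type u) [Group G] [Fintype G] :
    QuantumDouble G ⊗[ℂ] QuantumDouble G := ∑ k : G, ofGroup k ⊗ₜ[ℂ] ofDual k

open TensorProduct in
/-- The inverse `∑ k, k⁻¹ ⊗ k^*` of the `R`-matrix. -/
noncomputable def rMatrixInv (G : Type u) [Group G] [Fintype G] :
    QuantumDouble G ⊗[ℂ] QuantumDouble G := ∑ k : G, ofGroup k⁻¹ ⊗ₜ[ℂ] ofDual k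

end QuantumDouble

/-! ### Fluxon representations -/

/-- The conjugacy class of `g`, as a type. -/
def FluxClass {G : Type u} [Group G] (g : G) : Type u := {x : G // IsConj g x}

namespace FluxClass

variable {G : Type u} [Group G] {g : G}

noncomputable instance [Fintype G] : Fintype (FluxClass g) := by
  classical exact inferInstanceAs (Fintype {x : G // IsConj g x})

noncomputable instance : DecidableEq (FluxClass g) := Classical.decEq _

/-- The group element underlying a flux. -/
def elt (x : FluxClass g) : G := x.1

theorem ext_elt {x y : FluxClass g} (h : x.elt = y.elt) : x = y := Subtype.ext h

/-- `k x k⁻¹`. -/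
def conj (k : G) (x : FluxClass g) : FluxClass g :=
  ⟨k * x.1 * k⁻¹, x.2.trans (isConj_iff.2 ⟨k, rfl⟩)⟩

@[simp] theorem elt_conj (k : G) (x : FluxClass g) : (x.conj k).elt = k * x.elt * k⁻¹ := rfl

theorem conj_conj (k l : G) (x : FluxClass g) : (x.conj l).conj k = x.conj (k * l) :=
  ext_elt (by simp [mul_assoc])

@[simp] theorem conj_one (x : FluxClass g) : x.conj 1 = x := ext_elt (by simp)

end FluxClass

/-- The space of the irrep `([g], trivial)`, with basis the conjugacy class of `g`. -/
abbrev FluxSpace {G : Type u} [Group G] (g : G) : Type u := FluxClass g → ℂ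

section FluxonRep

variable {G : Type u} [Group G] [Fintype G] (g : G)

/-- The irrep `([g], trivial)` of `D(G)`: the linear extension of
`(k h^*) |x⟩ = δ_{h,x} |k x k⁻¹⟩` for `x` in the conjugacy class of `g`. -/
noncomputable def fluxonRep : QuantumDouble G →ₐ[ℂ] Module.End ℂ (FluxSpace g) :=
  AlgHom.ofLinearMap
    (LinearMap.mk₂ ℂ (fun (a : QuantumDouble G) (f : FluxSpace g) (y : FluxClass g) =>
        ∑ k : G, a.coeff k (y.conj k⁻¹).elt * f (y.conj k⁻¹))
      (fun a b f => by
        funext y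
        simp only [QuantumDouble.coeff_add, Pi.add_apply, add_mul, Finset.sum_add_distrib])
      (fun c a f => by
        funext y
        simp only [QuantumDouble.coeff_smul, Pi.smul_apply, smul_eq_mul, Finset.mul_sum,
          mul_assoc])
      (fun a f f' => by
        funext y
        simp only [Pi.add_apply, mul_add, Finset.sum_add_distrib])
      (fun c a f => by
        funext y
        simp only [Pi.smul_apply, smul_eq_mul, Finset.mul_sum, mul_left_comm]))
    (by
      refine LinearMap.ext fun f => funext fun y => ?_
      rw [LinearMap.mk₂_apply, Finset.sum_eq_single 1]
      · simp [QuantumDouble.coeff_one]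
      · intro k _ hk
        rw [QuantumDouble.coeff_one, if_neg hk, zero_mul]
      · simp)
    (by
      intro a b
      refine LinearMap.ext fun f => funext fun y => ?_
      simp only [LinearMap.mk₂_apply, Module.End.mul_apply, QuantumDouble.coeff_mul,
        Finset.sum_mul, Finset.mul_sum]
      rw [Finset.sum_comm]
      conv_rhs => rw [Finset.sum_comm]
      refine Finset.sum_congr rfl fun z _ => ?_
      rw [← Equiv.sum_comp (Equiv.mulRight z)]
      refine Finset.sum_congr rfl fun k _ => ?_
      simp [FluxClass.conj_conj, mul_assoc])

/-- The defining formula of the representation. -/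
theorem fluxonRep_apply (a : QuantumDouble G) (f : FluxSpace g) (y : FluxClass g) :
    fluxonRep g a f y = ∑ k : G, a.coeff k (y.conj k⁻¹).elt * f (y.conj k⁻¹) := rfl

end FluxonRep

/-! ### The braid group -/

/-- The braid relations on `σ_0, …, σ_{n-2}` (generators are numbered from `0`). -/
def braidRels (n : ℕ) : Set (FreeGroup (Fin (n - 1))) :=
  {r | (∃ i j : Fin (n - 1), (i : ℕ) + 2 ≤ j ∧
          r = .of i * .of j * (.of j * .of i)⁻¹) ∨
       (∃ i j : Fin (n - 1), (i : ℕ) + 1 = j ∧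
          r = .of i * .of j * .of i * (.of j * .of i * .of j)⁻¹)}

/-- The braid group `B_n`. -/
abbrev BraidGroup (n : ℕ) : Type := PresentedGroup (braidRels n)

/-- A braid word: a list of letters `(i, true)` for `σ_i` and `(i, false)` for `σ_i⁻¹`. -/
abbrev BraidWord (n : ℕ) : Type := List (Fin (n - 1) × Bool)

/-- The braid spelled by a word (`(i, true)` contributes `σ_i`, `(i, false)` its inverse). -/
def BraidWord.toBraid {n : ℕ} (w : BraidWord n) : BraidGroup n :=
  PresentedGroup.mk (braidRels n) (FreeGroup.mk w)

/-- The left one of the two strands crossed by `σ_i`. -/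
def leftStrand {n : ℕ} (i : Fin (n - 1)) : Fin n := ⟨i, by omega⟩

/-- The right one of the two strands crossed by `σ_i`. -/
def rightStrand {n : ℕ} (i : Fin (n - 1)) : Fin n := ⟨i + 1, by omega⟩

section Crossing

variable {G : Type u} [Group G] {g : G} {n : ℕ}

/-- `(…, a, b, …) ↦ (…, b, b a b⁻¹, …)` on the strands crossed by `σ_i`. -/
def crossFlux (i : Fin (n - 1)) (x : Fin n → FluxClass g) : Fin n → FluxClass g := fun k =>
  if k = leftStrand i then x (rightStrand i)
  else if k = rightStrand i then (x (leftStrand i)).conj (x (rightStrand i)).elt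
  else x k

/-- `(…, a, b, …) ↦ (…, a⁻¹ b a, a, …)` on the strands crossed by `σ_i`. -/
def uncrossFlux (i : Fin (n - 1)) (x : Fin n → FluxClass g) : Fin n → FluxClass g := fun k =>
  if k = leftStrand i then (x (rightStrand i)).conj (x (leftStrand i)).elt⁻¹
  else if k = rightStrand i then x (leftStrand i)
  else x k

theorem leftStrand_ne_rightStrand (i : Fin (n - 1)) : leftStrand i ≠ rightStrand i := by
  simp [leftStrand, rightStrand, Fin.ext_iff]

theorem uncrossFlux_crossFlux (i : Fin (n - 1)) (x : Fin n → FluxClass g) :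
    uncrossFlux i (crossFlux i x) = x := by
  have h := leftStrand_ne_rightStrand i
  funext k
  simp only [uncrossFlux, crossFlux]
  split_ifs <;> simp_all [FluxClass.conj_conj]

theorem crossFlux_uncrossFlux (i : Fin (n - 1)) (x : Fin n → FluxClass g) :
    crossFlux i (uncrossFlux i x) = x := by
  have h := leftStrand_ne_rightStrand i
  funext k
  simp only [uncrossFlux, crossFlux]
  split_ifs <;> simp_all [FluxClass.conj_conj]

theorem crossFlux_far {i j : Fin (n - 1)} (h : (i : ℕ) + 2 ≤ j) (x : Fin n → FluxClass g) :
    crossFlux i (crossFlux j x) = crossFlux j (crossFlux i x) := by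
  funext k
  simp only [crossFlux, leftStrand, rightStrand, Fin.ext_iff]
  split_ifs <;> first | rfl | (exfalso; omega)

theorem crossFlux_near {i j : Fin (n - 1)} (h : (i : ℕ) + 1 = j) (x : Fin n → FluxClass g) :
    crossFlux i (crossFlux j (crossFlux i x)) = crossFlux j (crossFlux i (crossFlux j x)) := by
  have hj : leftStrand j = rightStrand i := Fin.ext h.symm
  have h1 := leftStrand_ne_rightStrand i
  have h2 : leftStrand i ≠ rightStrand j := by
    simp only [leftStrand, rightStrand, ne_eq, Fin.ext_iff]; omega
  have h3 : rightStrand i ≠ rightStrand j := hj ▸ leftStrand_ne_rightStrand j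
  funext k
  simp only [crossFlux, hj]
  split_ifs <;> simp_all [FluxClass.conj_conj, Ne.symm h1, Ne.symm h2, Ne.symm h3]

end Crossing

section BraidRep

open TensorProduct

variable {G : Type u} [Group G] [Fintype G] (g : G) (n : ℕ)

/-- The `n`-fold tensor power of the irrep `([g], trivial)`. -/
abbrev FluxTensor : Type u := ⨂[ℂ] _ : Fin n, FluxSpace g

/-- The basis of the tensor power made of the vectors `|x_1⟩ ⊗ ⋯ ⊗ |x_n⟩`. -/
noncomputable def fluxBasis : Module.Basis (Fin n → FluxClass g) ℂ (FluxTensor g n) :=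
  Basis.piTensorProduct fun _ => Pi.basisFun ℂ (FluxClass g)

variable {n}

/-- `a ∈ D(G)` acting on the tensor factor number `k`. -/
noncomputable def actAt (k : Fin n) : QuantumDouble G →ₗ[ℂ] Module.End ℂ (FluxTensor g n) :=
  ((PiTensorProduct.mapMultilinear ℂ (fun _ : Fin n => FluxSpace g)
    (fun _ : Fin n => FluxSpace g)).toLinearMap (fun _ => LinearMap.id) k) ∘ₗ
    (fluxonRep g).toLinearMap

/-- An element of `D(G) ⊗ D(G)` acting on the tensor factors number `j` and `k`. -/
noncomputable def actPair (j k : Fin n) :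
    QuantumDouble G ⊗[ℂ] QuantumDouble G →ₗ[ℂ] Module.End ℂ (FluxTensor g n) :=
  LinearMap.mul' ℂ (Module.End ℂ (FluxTensor g n)) ∘ₗ TensorProduct.map (actAt g j) (actAt g k)

/-- The exchange `T` of the tensor factors number `j` and `k`. -/
noncomputable def exchangeAt (j k : Fin n) : Module.End ℂ (FluxTensor g n) :=
  (PiTensorProduct.reindex ℂ (fun _ : Fin n => FluxSpace g) (Equiv.swap j k)).toLinearMap

/-- The operator `I ⊗ TR ⊗ I` assigned to `σ_i`. -/
noncomputable def crossing (i : Fin (n - 1)) : Module.End ℂ (FluxTensor g n) :=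
  exchangeAt g (leftStrand i) (rightStrand i) *
    actPair g (leftStrand i) (rightStrand i) (QuantumDouble.rMatrix G)

/-- The operator `I ⊗ R⁻¹T ⊗ I`. -/
noncomputable def crossingInv (i : Fin (n - 1)) : Module.End ℂ (FluxTensor g n) :=
  actPair g (leftStrand i) (rightStrand i) (QuantumDouble.rMatrixInv G) *
    exchangeAt g (leftStrand i) (rightStrand i)

theorem fluxBasis_apply (x : Fin n → FluxClass g) :
    fluxBasis g n x = PiTensorProduct.tprod ℂ fun k => (Pi.single (x k) 1 : FluxSpace g) := by
  simp [fluxBasis]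

theorem fluxonRep_ofGroup (k : G) (x : FluxClass g) :
    fluxonRep g (QuantumDouble.ofGroup k) (Pi.single x 1) = Pi.single (x.conj k) 1 := by
  funext y
  rw [fluxonRep_apply, Finset.sum_eq_single k]
  · have h : y.conj k⁻¹ = x ↔ y = x.conj k := by
      constructor
      · rintro rfl; simp [FluxClass.conj_conj]
      · rintro rfl; simp [FluxClass.conj_conj]
    simp [QuantumDouble.ofGroup, Pi.single_apply, h]
  · intro b _ hb
    simp [QuantumDouble.ofGroup, hb]
  · simp

open Classical in
theorem fluxonRep_ofDual (k : G) (x : FluxClass g) :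
    fluxonRep g (QuantumDouble.ofDual k) (Pi.single x 1) =
      if x.elt = k then Pi.single x 1 else 0 := by
  funext y
  rw [fluxonRep_apply, Finset.sum_eq_single 1]
  · by_cases h : y = x
    · subst h
      by_cases h' : y.elt = k <;> simp [QuantumDouble.ofDual, h']
    · by_cases h' : x.elt = k <;> simp [QuantumDouble.ofDual, h, h']
  · intro b _ hb
    simp [QuantumDouble.ofDual, hb]
  · simp

theorem actAt_tprod (k : Fin n) (a : QuantumDouble G) (v : Fin n → FluxSpace g) :
    actAt g k a (PiTensorProduct.tprod ℂ v) =
      PiTensorProduct.tprod ℂ (Function.update v k (fluxonRep g a (v k))) := by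
  simp only [actAt, LinearMap.comp_apply, MultilinearMap.toLinearMap_apply,
    PiTensorProduct.mapMultilinear_apply, PiTensorProduct.map_tprod]
  congr 1
  funext l
  by_cases h : l = k
  · subst h; simp
  · simp [h]

theorem actAt_ofGroup (j : Fin n) (k : G) (x : Fin n → FluxClass g) :
    actAt g j (QuantumDouble.ofGroup k) (fluxBasis g n x) =
      fluxBasis g n (Function.update x j ((x j).conj k)) := by
  rw [fluxBasis_apply, actAt_tprod, fluxonRep_ofGroup, fluxBasis_apply]
  congr 1
  funext l
  by_cases h : l = j
  · subst h; simp
  · simp [h]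

open Classical in
theorem actAt_ofDual (j : Fin n) (k : G) (x : Fin n → FluxClass g) :
    actAt g j (QuantumDouble.ofDual k) (fluxBasis g n x) =
      if (x j).elt = k then fluxBasis g n x else 0 := by
  rw [fluxBasis_apply, actAt_tprod, fluxonRep_ofDual]
  split_ifs with h
  · simp
  · exact MultilinearMap.map_coord_zero _ j (by simp)

theorem actPair_sum (c : G → G) {j k : Fin n} (x : Fin n → FluxClass g) :
    actPair g j k (∑ h : G, QuantumDouble.ofGroup (c h) ⊗ₜ[ℂ] QuantumDouble.ofDual h)
      (fluxBasis g n x) =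
      fluxBasis g n (Function.update x j ((x j).conj (c (x k).elt))) := by
  simp only [actPair, map_sum, LinearMap.comp_apply, TensorProduct.map_tmul,
    LinearMap.mul'_apply, LinearMap.sum_apply, Module.End.mul_apply, actAt_ofDual]
  rw [Finset.sum_eq_single (x k).elt]
  · rw [if_pos rfl, actAt_ofGroup]
  · intro h _ hh
    rw [if_neg (Ne.symm hh), map_zero]
  · simp

theorem exchangeAt_fluxBasis (j k : Fin n) (x : Fin n → FluxClass g) :
    exchangeAt g j k (fluxBasis g n x) = fluxBasis g n (x ∘ Equiv.swap j k) := by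
  simp only [exchangeAt, fluxBasis_apply, LinearEquiv.coe_coe, Function.comp_apply]
  exact PiTensorProduct.reindex_tprod _ _

theorem crossing_fluxBasis (i : Fin (n - 1)) (x : Fin n → FluxClass g) :
    crossing g i (fluxBasis g n x) = fluxBasis g n (crossFlux i x) := by
  have h := leftStrand_ne_rightStrand i
  rw [crossing, Module.End.mul_apply, QuantumDouble.rMatrix, actPair_sum g (fun h => h),
    exchangeAt_fluxBasis]
  congr 1
  funext k
  simp only [crossFlux, Function.comp_apply, Equiv.swap_apply_def]
  split_ifs <;> simp_all [Ne.symm h]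

theorem crossingInv_fluxBasis (i : Fin (n - 1)) (x : Fin n → FluxClass g) :
    crossingInv g i (fluxBasis g n x) = fluxBasis g n (uncrossFlux i x) := by
  have h := leftStrand_ne_rightStrand i
  rw [crossingInv, Module.End.mul_apply, QuantumDouble.rMatrixInv, exchangeAt_fluxBasis,
    actPair_sum g (fun h => h⁻¹)]
  congr 1
  funext k
  by_cases h1 : k = leftStrand i
  · subst h1; simp [uncrossFlux]
  · by_cases h2 : k = rightStrand i
    · subst h2; simp [uncrossFlux, h1]
    · simp [uncrossFlux, h1, h2, Equiv.swap_apply_of_ne_of_ne h1 h2]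

/-- The operator of `σ_i`, as an invertible operator. -/
noncomputable def crossingUnit (i : Fin (n - 1)) : (Module.End ℂ (FluxTensor g n))ˣ where
  val := crossing g i
  inv := crossingInv g i
  val_inv := (fluxBasis g n).ext fun x => by
    simp [Module.End.mul_apply, crossing_fluxBasis, crossingInv_fluxBasis, crossFlux_uncrossFlux]
  inv_val := (fluxBasis g n).ext fun x => by
    simp [Module.End.mul_apply, crossing_fluxBasis, crossingInv_fluxBasis, uncrossFlux_crossFlux]

theorem braidRels_hold (r : FreeGroup (Fin (n - 1))) (hr : r ∈ braidRels n) :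
    FreeGroup.lift (crossingUnit (n := n) g) r = 1 := by
  rcases hr with ⟨i, j, h, rfl⟩ | ⟨i, j, h, rfl⟩
  · simp only [map_mul, map_inv, FreeGroup.lift_apply_of, mul_inv_eq_one]
    refine Units.ext ((fluxBasis g n).ext fun x => ?_)
    simp [crossingUnit, crossing_fluxBasis, crossFlux_far h]
  · simp only [map_mul, map_inv, FreeGroup.lift_apply_of, mul_inv_eq_one]
    refine Units.ext ((fluxBasis g n).ext fun x => ?_)
    simp [crossingUnit, crossing_fluxBasis, crossFlux_near h]

variable (n)

/-- The braid group representation `τ` on the `n`-fold tensor power, `σ_i ↦ I ⊗ TR ⊗ I`. -/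
noncomputable def braidRep : BraidGroup n →* (Module.End ℂ (FluxTensor g n))ˣ :=
  PresentedGroup.toGroup (braidRels_hold g)

variable {n}

/-- The matrix `⟨y| τ(b) |x⟩` in the basis of flux configurations. -/
noncomputable def braidMatrix (b : BraidGroup n) :
    Matrix (Fin n → FluxClass g) (Fin n → FluxClass g) ℂ :=
  LinearMap.toMatrix (fluxBasis g n) (fluxBasis g n) (braidRep g n b).val

/-- The dimension of the irrep `([g], trivial)`. -/
noncomputable def fluxDim : ℕ := Fintype.card (FluxClass g)

/-- The trace closure `d⁻¹ ⟨g⟩^{-e(b)} tr τ(b)`; the factor `⟨g⟩ = χ_ρ(g) / d_ρ` is `1`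
because `ρ` is the trivial representation of the centralizer. -/
noncomputable def traceClosure (b : BraidGroup n) : ℂ :=
  (fluxDim g : ℂ)⁻¹ * LinearMap.trace ℂ (FluxTensor g n) (braidRep g n b).val

/-- The coordinates of `|Φ⟩ = d^{-1/2} ∑ x, |x, x⁻¹⟩`, the invariant vector of the tensor square
of a self-dual irrep `([g], trivial)`. -/
noncomputable def pairState (x y : FluxClass g) : ℂ :=
  open Classical in if y.elt = x.elt⁻¹ then ((1 / √(fluxDim g : ℝ) : ℝ) : ℂ) else 0

/-- The coordinates of `|α⟩ = |Φ⟩^{⊗ l}`. -/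
noncomputable def platState (l : ℕ) (x : Fin (2 * l) → FluxClass g) : ℂ :=
  ∏ j : Fin l, pairState g (x ⟨2 * j, by omega⟩) (x ⟨2 * j + 1, by omega⟩)

/-- The plat closure `⟨α| τ(b) |α⟩`. -/
noncomputable def platClosure {l : ℕ} (b : BraidGroup (2 * l)) : ℂ :=
  star (platState g l) ⬝ᵥ (braidMatrix g b).mulVec (platState g l)

end BraidRep

/-! ### Randomized random access machines with logarithmic cost -/

/-- The multiplication and inversion tables of a finite group, available to a machine by random
access. -/
structure GroupTables where
  /-- the multiplication table -/
  mul : ℕ → ℕ → ℕ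
  /-- the inversion table -/
  inv : ℕ → ℕ

open Classical in
/-- The tables of `G` for the labelling `lab` of its elements by `0, …, |G| - 1`
(entries outside the table are `0`). -/
noncomputable def groupTables {G : Type u} [Group G] [Fintype G]
    (lab : G ≃ Fin (Fintype.card G)) : GroupTables where
  mul i j := if h : i < Fintype.card G ∧ j < Fintype.card G then
    lab (lab.symm ⟨i, h.1⟩ * lab.symm ⟨j, h.2⟩) else 0
  inv i := if h : i < Fintype.card G then lab (lab.symm ⟨i, h⟩)⁻¹ else 0

/-- The state of a machine: registers and arrays of natural numbers, and the coin tosses that have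
not been used yet. -/
structure RState where
  /-- the registers -/
  reg : ℕ → ℕ
  /-- the arrays -/
  arr : ℕ → ℕ → ℕ
  /-- the unused coin tosses -/
  coins : List Bool

/-- The content of register `0` divided by that of register `1`. -/
def RState.output (s : RState) : ℚ := (s.reg 0 : ℚ) / (s.reg 1 : ℚ)

/-- Overwrite register `x`. -/
def RState.setReg (s : RState) (x v : ℕ) : RState :=
  ⟨Function.update s.reg x v, s.arr, s.coins⟩

/-- Overwrite cell `i` of array `a`. -/
def RState.setArr (s : RState) (a i v : ℕ) : RState :=
  ⟨s.reg, Function.update s.arr a (Function.update (s.arr a) i v), s.coins⟩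

/-- Replace the list of unused coin tosses. -/
def RState.setCoins (s : RState) (l : List Bool) : RState := ⟨s.reg, s.arr, l⟩

/-- Expressions: constants, registers, array cells, arithmetic, comparisons, and look-ups in the
group tables. -/
inductive RExpr where
  | const (c : ℕ)
  | reg (x : ℕ)
  | get (a : ℕ) (e : RExpr)
  | add (e f : RExpr)
  | sub (e f : RExpr)
  | mul (e f : RExpr)
  | div (e f : RExpr)
  | mod (e f : RExpr)
  | lt (e f : RExpr)
  | eq (e f : RExpr)
  | gmul (e f : RExpr)
  | ginv (e : RExpr)

/-- The value of an expression (comparisons give `0` or `1`, subtraction is truncated). -/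
def RExpr.eval (tab : GroupTables) (s : RState) : RExpr → ℕ
  | const c => c
  | reg x => s.reg x
  | get a e => s.arr a (e.eval tab s)
  | add e f => e.eval tab s + f.eval tab s
  | sub e f => e.eval tab s - f.eval tab s
  | mul e f => e.eval tab s * f.eval tab s
  | div e f => e.eval tab s / f.eval tab s
  | mod e f => e.eval tab s % f.eval tab s
  | lt e f => if e.eval tab s < f.eval tab s then 1 else 0
  | eq e f => if e.eval tab s = f.eval tab s then 1 else 0
  | gmul e f => tab.mul (e.eval tab s) (f.eval tab s)
  | ginv e => tab.inv (e.eval tab s)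

/-- The logarithmic cost of evaluating an expression: every node costs one more than the bit length
of its value. -/
def RExpr.cost (tab : GroupTables) (s : RState) : RExpr → ℕ
  | const c => Nat.size c + 1
  | reg x => Nat.size (s.reg x) + 1
  | get a e => e.cost tab s + Nat.size ((get a e).eval tab s) + 1
  | add e f => e.cost tab s + f.cost tab s + Nat.size ((add e f).eval tab s) + 1
  | sub e f => e.cost tab s + f.cost tab s + Nat.size ((sub e f).eval tab s) + 1
  | mul e f => e.cost tab s + f.cost tab s + Nat.size ((mul e f).eval tab s) + 1
  | div e f => e.cost tab s + f.cost tab s + Nat.size ((div e f).eval tab s) + 1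
  | mod e f => e.cost tab s + f.cost tab s + Nat.size ((mod e f).eval tab s) + 1
  | lt e f => e.cost tab s + f.cost tab s + Nat.size ((lt e f).eval tab s) + 1
  | eq e f => e.cost tab s + f.cost tab s + Nat.size ((eq e f).eval tab s) + 1
  | gmul e f => e.cost tab s + f.cost tab s + Nat.size ((gmul e f).eval tab s) + 1
  | ginv e => e.cost tab s + Nat.size ((ginv e).eval tab s) + 1

/-- Programs. -/
inductive RProg where
  /-- do nothing -/
  | skip
  /-- put the value of an expression into a register -/
  | assign (x : ℕ) (e : RExpr)
  /-- put the value of `f` into the cell of array `a` numbered by the value of `e` -/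
  | store (a : ℕ) (e f : RExpr)
  /-- put a fair random bit into a register -/
  | coin (x : ℕ)
  /-- run `P`, then `Q` -/
  | seq (P Q : RProg)
  /-- run `P` if the expression is not `0`, otherwise run `Q` -/
  | ite (e : RExpr) (P Q : RProg)
  /-- run `P` as long as the expression is not `0` -/
  | loop (e : RExpr) (P : RProg)

/-- `Exec tab P s s' t`: started in the state `s`, the program `P` halts in the state `s'` after
`t` units of time. There is no run that tosses a coin when the list of coins is used up. -/
inductive Exec (tab : GroupTables) : RProg → RState → RState → ℕ → Prop where
  | skip (s : RState) : Exec tab .skip s s 1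
  | assign (x : ℕ) (e : RExpr) (s : RState) :
      Exec tab (.assign x e) s (s.setReg x (e.eval tab s)) (e.cost tab s + 1)
  | store (a : ℕ) (e f : RExpr) (s : RState) :
      Exec tab (.store a e f) s (s.setArr a (e.eval tab s) (f.eval tab s))
        (e.cost tab s + f.cost tab s + 1)
  | coin (x : ℕ) (b : Bool) (l : List Bool) (s : RState) (h : s.coins = b :: l) :
      Exec tab (.coin x) s ((s.setReg x b.toNat).setCoins l) 1
  | seq {P Q : RProg} {s s' s'' : RState} {t t' : ℕ} (hP : Exec tab P s s' t)
      (hQ : Exec tab Q s' s'' t') : Exec tab (.seq P Q) s s'' (t + t' + 1)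
  | ite_true {e : RExpr} {P Q : RProg} {s s' : RState} {t : ℕ} (he : e.eval tab s ≠ 0)
      (hP : Exec tab P s s' t) : Exec tab (.ite e P Q) s s' (e.cost tab s + t + 1)
  | ite_false {e : RExpr} {P Q : RProg} {s s' : RState} {t : ℕ} (he : e.eval tab s = 0)
      (hQ : Exec tab Q s s' t) : Exec tab (.ite e P Q) s s' (e.cost tab s + t + 1)
  | loop_true {e : RExpr} {P : RProg} {s s' s'' : RState} {t t' : ℕ} (he : e.eval tab s ≠ 0)
      (hP : Exec tab P s s' t) (hL : Exec tab (.loop e P) s' s'' t') :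
      Exec tab (.loop e P) s s'' (e.cost tab s + t + t' + 1)
  | loop_false {e : RExpr} {P : RProg} {s : RState} (he : e.eval tab s = 0) :
      Exec tab (.loop e P) s s (e.cost tab s + 1)

/-- Started without coins, `P` halts within `T` units of time and outputs a number with the
property `good`. -/
def ComputesWithin (tab : GroupTables) (P : RProg) (inp : List Bool → RState) (T : ℕ)
    (good : ℚ → Prop) : Prop :=
  ∃ (s : RState) (t : ℕ), Exec tab P (inp []) s t ∧ t ≤ T ∧ good s.output

/-- For every outcome of the coin tosses `P` halts within `T` units of time, and the probability
over `T` fair coin tosses that its output does not have the property `good` is less than `1/4`. -/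
def ApproximatesWithin (tab : GroupTables) (P : RProg) (inp : List Bool → RState) (T : ℕ)
    (good : ℚ → Prop) : Prop :=
  (∀ r : Fin T → Bool, ∃ (s : RState) (t : ℕ),
    Exec tab P (inp (List.ofFn r)) s t ∧ t ≤ T) ∧
  (Nat.card {r : Fin T → Bool // ∃ (s : RState) (t : ℕ),
    Exec tab P (inp (List.ofFn r)) s t ∧ ¬ good s.output} : ℝ) / 2 ^ T < 1 / 4

section Input

variable {G : Type u} [Group G] [Fintype G] (lab : G ≃ Fin (Fintype.card G)) (g : G) {n : ℕ}

/-- The input that consists of `|G|`, the label of `g`, the number of strands, the length of the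
braid word, and an accuracy parameter `k` (registers `0` to `4`), and of the indices and signs of
the letters of the word (arrays `0` and `1`). -/
noncomputable def braidInput (w : BraidWord n) (k : ℕ) (coins : List Bool) : RState where
  reg
    | 0 => Fintype.card G
    | 1 => lab g
    | 2 => n
    | 3 => w.length
    | 4 => k
    | _ => 0
  arr
    | 0, j => (w.map fun l => (l.1 : ℕ)).getD j 0
    | 1, j => (w.map fun l => l.2.toNat).getD j 0
    | _, _ => 0
  coins := coins

variable {g}

/-- The labels of a flux configuration. -/
noncomputable def fluxLabels (x : Fin n → FluxClass g) (j : ℕ) : ℕ :=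
  if h : j < n then lab (x ⟨j, h⟩).elt else 0

/-- The same input together with the labels of two flux configurations `x` and `y`
(arrays `2` and `3`). -/
noncomputable def entryInput (w : BraidWord n) (x y : Fin n → FluxClass g) (coins : List Bool) :
    RState :=
  (fun s : RState => ⟨s.reg, fun a => if a = 2 then fluxLabels lab x
    else if a = 3 then fluxLabels lab y else s.arr a, s.coins⟩) (braidInput lab g w 0 coins)

end Input

/-! The operator `TR` sends each basis vector `|a, b⟩` to the basis vector `|b, b a b⁻¹⟩`, so a
braid merely permutes the flux configurations in `C^n` (`braidRep_fluxBasis`,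
`braidMatrix_toBraid`). A matrix entry is therefore found by following one configuration through the
word with table look-ups and comparing the result with the target.

The trace counts fixed configurations, so the normalized trace closure is the probability that a
uniform configuration is fixed (`traceClosure_toBraid`). The state `|α⟩` has equal coordinates on
the `d ^ l` configurations of the form `(x, x⁻¹, y, y⁻¹, …)`, so the plat closure is the probability
that a uniform configuration of this form is carried to another one. Overwriting the odd positions
of a uniform configuration by inverses of their left neighbours gives a uniform configuration of
this form (`platClosure_toBraid`). Both invariants are thus means of an easily decided property, and
are estimated by sampling.

A uniform flux is `h g h⁻¹` for uniform `h` in `G` (`sum_conj_div`). The machine draws `h` as a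
`K`-bit number modulo `|G|`, which shifts the mean over `n` strands by at most `n |G| / 2 ^ K`
(`abs_coinMean_drawConfig_sub_le`). With `k = ⌈1/ε⌉` and `2 ^ K ≥ 2 k n |G|` this bias is at most `1
/ (2k)`. By Chebyshev (`coinMean_blockSum_tail`), `5 k²` independent trials deviate from their mean
by more than `1 / (2k)` with probability at most `1/5`. The two errors together are at most `1/k ≤
ε`.

For the running time, every number met has at most `L` bits, with `L` linear in `m`, `n`, `log |G|`
and `k`. Each node of an expression then costs at most `L + 1`, and Hoare-style rules for `Reach`
give both correctness and a polynomial time bound. -/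

/-! ### Braids as permutations of flux configurations; closures as averages -/

section BraidAction

variable {G : Type u} [Group G] {g : G} {n : ℕ}

/-- The action of one letter of a braid word on flux configurations. -/
def letterAct (a : Fin (n - 1) × Bool) (x : Fin n → FluxClass g) : Fin n → FluxClass g :=
  if a.2 then crossFlux a.1 x else uncrossFlux a.1 x

/-- The action of a braid word on flux configurations; the last letter acts first. -/
def wordAct (w : BraidWord n) (x : Fin n → FluxClass g) : Fin n → FluxClass g :=
  w.foldr letterAct x

theorem letterAct_not (a : Fin (n - 1) × Bool) (x : Fin n → FluxClass g) :
    letterAct (a.1, !a.2) (letterAct a x) = x := by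
  rcases a with ⟨i, _ | _⟩
  · exact crossFlux_uncrossFlux i x
  · exact uncrossFlux_crossFlux i x

theorem letterAct_bijective (a : Fin (n - 1) × Bool) :
    Function.Bijective (letterAct (g := g) a) :=
  Function.bijective_iff_has_inverse.2 ⟨letterAct (a.1, !a.2), letterAct_not a, fun x => by
    simpa using letterAct_not (a.1, !a.2) x⟩

theorem wordAct_bijective (w : BraidWord n) : Function.Bijective (wordAct (g := g) w) := by
  induction w with
  | nil => exact Function.bijective_id
  | cons a w ih => exact (letterAct_bijective a).comp ih

/-- The inverse flux, for a class that is closed under inversion. -/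
def FluxClass.inv (h : IsConj g g⁻¹) (x : FluxClass g) : FluxClass g :=
  ⟨x.1⁻¹, h.trans (by
    obtain ⟨c, hc⟩ := isConj_iff.1 x.2
    exact isConj_iff.2 ⟨c, by rw [← hc]; group⟩)⟩

@[simp] theorem FluxClass.elt_inv (h : IsConj g g⁻¹) (x : FluxClass g) :
    (x.inv h).elt = x.elt⁻¹ := rfl

/-- Replace every flux in an odd position by the inverse of its left neighbour. -/
def mirror (h : IsConj g g⁻¹) (x : Fin n → FluxClass g) : Fin n → FluxClass g := fun j =>
  if (j : ℕ) % 2 = 1 then (x ⟨j - 1, by omega⟩).inv h else x j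

/-- Even positions are never changed, and the odd ones depend only on them. So `mirror` is a
retraction onto the configurations that support `|α⟩`. -/
theorem mirror_mirror (h : IsConj g g⁻¹) (x : Fin n → FluxClass g) :
    mirror h (mirror h x) = mirror h x := by
  funext j
  by_cases hj : (j : ℕ) % 2 = 1
  · have h' : ¬ ((j : ℕ) - 1) % 2 = 1 := by omega
    simp [mirror, hj, h']
  · simp [mirror, hj]

variable [Fintype G]

theorem braidRep_fluxBasis (w : BraidWord n) (x : Fin n → FluxClass g) :
    (braidRep g n w.toBraid).val (fluxBasis g n x) = fluxBasis g n (wordAct w x) := by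
  have h : braidRep g n w.toBraid = FreeGroup.lift (crossingUnit (n := n) g) (FreeGroup.mk w) :=
    rfl
  rw [h, FreeGroup.lift_mk]
  clear h
  induction w with
  | nil => rfl
  | cons a w ih =>
    rw [List.map_cons, List.prod_cons, Units.val_mul, Module.End.mul_apply, ih]
    rcases a with ⟨i, _ | _⟩
    · exact crossingInv_fluxBasis g i _
    · exact crossing_fluxBasis g i _

theorem braidMatrix_toBraid (w : BraidWord n) (y x : Fin n → FluxClass g) :
    braidMatrix g w.toBraid y x = if wordAct w x = y then 1 else 0 := by
  rw [braidMatrix, LinearMap.toMatrix_apply, braidRep_fluxBasis, Module.Basis.repr_self,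
    Finsupp.single_apply]

theorem exists_toBraid_eq (b : BraidGroup n) : ∃ w : BraidWord n, w.toBraid = b := by
  obtain ⟨a, rfl⟩ := PresentedGroup.mk_surjective _ b
  exact ⟨a.toWord, by rw [BraidWord.toBraid, FreeGroup.mk_toWord]⟩

theorem exists_braidMatrix_eq_permMatrix (b : BraidGroup n) :
    ∃ π : Equiv.Perm (Fin n → FluxClass g), braidMatrix g b = π.permMatrix ℂ := by
  obtain ⟨w, rfl⟩ := exists_toBraid_eq b
  -- `permMatrix` has its ones at `(y, π y)`, whereas the column `x` of the braid matrix has its one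
  -- in the row `wordAct w x`; hence the inverse.
  refine ⟨(Equiv.ofBijective _ (wordAct_bijective w)).symm, ?_⟩
  ext y x
  rw [braidMatrix_toBraid, Equiv.Perm.permMatrix, PEquiv.toMatrix_apply]
  refine if_congr ?_ rfl rfl
  rw [Equiv.toPEquiv_apply, Option.mem_some_iff, Equiv.symm_apply_eq, Equiv.ofBijective_apply,
    eq_comm]

theorem fluxDim_pos : 0 < fluxDim g :=
  Fintype.card_pos_iff.2 ⟨(⟨g, IsConj.refl g⟩ : {x : G // IsConj g x})⟩

open Classical in
theorem trace_braidRep (w : BraidWord n) :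
    LinearMap.trace ℂ (FluxTensor g n) (braidRep g n w.toBraid).val =
      ((Finset.univ.filter fun x : Fin n → FluxClass g => wordAct w x = x).card : ℂ) := by
  rw [LinearMap.trace_eq_matrix_trace ℂ (fluxBasis g n), Matrix.trace, Finset.card_filter]
  push_cast
  exact Finset.sum_congr rfl fun x _ => (braidMatrix_toBraid w x x).trans (if_congr Iff.rfl rfl rfl)

/-- The average of a function on flux configurations. -/
noncomputable def fluxMean (g : G) (n : ℕ) (f : (Fin n → FluxClass g) → ℝ) : ℝ :=
  (∑ x, f x) / (fluxDim g : ℝ) ^ n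

open Classical in
theorem traceClosure_toBraid (w : BraidWord n) (hn : 1 ≤ n) :
    traceClosure g w.toBraid =
      ((fluxMean g n fun x => if wordAct w x = x then 1 else 0 : ℝ) : ℂ) *
        (fluxDim g : ℂ) ^ (n - 1) := by
  have hd : (fluxDim g : ℂ) ≠ 0 := Nat.cast_ne_zero.2 fluxDim_pos.ne'
  obtain ⟨n, rfl⟩ := Nat.exists_eq_add_of_le' hn
  rw [traceClosure, trace_braidRep, fluxMean, Finset.card_filter]
  push_cast [apply_ite ((↑) : ℝ → ℂ)]
  rw [pow_succ]
  field_simp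

/-- A product of `l` pair coordinates vanishes as soon as one pair is not of the form `(x, x⁻¹)`;
being fixed by `mirror` says that all pairs have this form. -/
theorem platState_eq (h : IsConj g g⁻¹) (l : ℕ) (x : Fin (2 * l) → FluxClass g) :
    platState g l x =
      open Classical in if mirror h x = x then (((1 / √(fluxDim g : ℝ)) ^ l : ℝ) : ℂ) else 0 := by
  have key : mirror h x = x ↔
      ∀ j : Fin l, (x ⟨2 * j + 1, by omega⟩).elt = (x ⟨2 * j, by omega⟩).elt⁻¹ := by
    constructor
    · intro hx j
      have := congrArg FluxClass.elt (congrFun hx ⟨2 * j + 1, by omega⟩)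
      simpa [mirror, Nat.add_mod] using this.symm
    · intro hx
      funext j
      refine FluxClass.ext_elt ?_
      by_cases hj : (j : ℕ) % 2 = 1
      · have h2 := hx ⟨(j : ℕ) / 2, by omega⟩
        have e1 : (⟨2 * ((j : ℕ) / 2) + 1, by omega⟩ : Fin (2 * l)) = j := Fin.ext (by grind)
        have e2 : (⟨2 * ((j : ℕ) / 2), by omega⟩ : Fin (2 * l)) = ⟨j - 1, by omega⟩ :=
          Fin.ext (by grind)
        simp only [e1, e2] at h2
        simp [mirror, hj, h2]
      · simp [mirror, hj]
  classical
  simp only [platState, pairState]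
  split_ifs with hx
  · rw [Finset.prod_congr rfl fun j _ => if_pos (key.1 hx j)]
    simp
  · rw [key] at hx
    push Not at hx
    obtain ⟨j, hj⟩ := hx
    exact Finset.prod_eq_zero (Finset.mem_univ j) (if_neg hj)

theorem prod_range_two_mul_ite (d : ℝ) (l : ℕ) :
    ∏ j ∈ Finset.range (2 * l), (if j % 2 = 1 then d else 1) = d ^ l := by
  induction l with
  | zero => simp
  | succ l ih =>
    rw [Nat.mul_succ, Finset.prod_range_succ, Finset.prod_range_succ, ih, pow_succ]
    simp [Nat.add_mod]

open Classical in
-- The even positions of a preimage are forced and the `l` odd ones are free. As all fibres over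
-- fixed points of `mirror` have the same size, `mirror` turns a uniform configuration into a
-- uniform plat configuration.
theorem card_mirror_fiber (h : IsConj g g⁻¹) (l : ℕ) (z : Fin (2 * l) → FluxClass g)
    (hz : mirror h z = z) :
    ((Finset.univ.filter fun x => mirror h x = z).card : ℝ) = (fluxDim g : ℝ) ^ l := by
  have : (Finset.univ.filter fun x => mirror h x = z) =
      Fintype.piFinset fun j : Fin (2 * l) =>
        if (j : ℕ) % 2 = 1 then (Finset.univ : Finset (FluxClass g)) else {z j} := by
    ext x
    simp only [Finset.mem_filter, Finset.mem_univ, true_and, Fintype.mem_piFinset]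
    constructor
    · rintro rfl j
      by_cases hj : (j : ℕ) % 2 = 1 <;> simp [mirror, hj]
    · intro hx
      rw [← hz]
      funext j
      by_cases hj : (j : ℕ) % 2 = 1
      · have h' : ¬ ((j : ℕ) - 1) % 2 = 1 := by omega
        have := hx ⟨j - 1, by omega⟩
        simp only [h', if_false, Finset.mem_singleton] at this
        simp [mirror, hj, this]
      · have := hx j
        simp only [hj, if_false, Finset.mem_singleton] at this
        simp [mirror, hj, this]
  rw [this, Fintype.card_piFinset, ← prod_range_two_mul_ite, Finset.prod_range]
  push_cast
  refine Finset.prod_congr rfl fun j _ => ?_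
  split_ifs
  · rfl
  · simp

open Classical in
theorem platClosure_toBraid (h : IsConj g g⁻¹) (l : ℕ) (w : BraidWord (2 * l)) :
    platClosure g w.toBraid = ((fluxMean g (2 * l) fun x =>
      if mirror h (wordAct w (mirror h x)) = wordAct w (mirror h x) then 1 else 0 : ℝ) : ℂ) := by
  have hd : (fluxDim g : ℝ) ≠ 0 := Nat.cast_ne_zero.2 fluxDim_pos.ne'
  set F : (Fin (2 * l) → FluxClass g) → ℝ := fun z =>
    if mirror h (wordAct w z) = wordAct w z then 1 else 0 with hF
  -- Sort the configurations by their mirror image; only fixed points of `mirror` have nonempty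
  -- fibres.
  have h1 : ∑ x, F (mirror h x) =
      (fluxDim g : ℝ) ^ l * ∑ z, if mirror h z = z then F z else 0 := by
    rw [← Finset.sum_fiberwise_of_maps_to (s := Finset.univ) (t := Finset.univ)
      (g := mirror h) (fun _ _ => Finset.mem_univ _), Finset.mul_sum]
    refine Finset.sum_congr rfl fun z _ => ?_
    rw [Finset.sum_congr rfl (g := fun _ => F z) fun x hx => by rw [(Finset.mem_filter.1 hx).2],
      Finset.sum_const, nsmul_eq_mul]
    split_ifs with hz
    · rw [card_mirror_fiber h l z hz]
    · rw [Finset.card_eq_zero.2, Nat.cast_zero, zero_mul, mul_zero]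
      refine Finset.filter_eq_empty_iff.2 fun x _ hx => hz ?_
      rw [← hx, mirror_mirror]
  -- The row `wordAct w z` has its only nonzero entry in the column `z`. Reindexing by `wordAct w`
  -- then reduces the double sum of `⟨α|τ|α⟩` to a single one.
  have h2 : ∀ z, (braidMatrix g w.toBraid).mulVec (platState g l) (wordAct w z) =
      platState g l z := by
    intro z
    rw [Matrix.mulVec, dotProduct, Finset.sum_eq_single z]
    · rw [braidMatrix_toBraid, if_pos rfl, one_mul]
    · intro x _ hx
      rw [braidMatrix_toBraid, if_neg fun e => hx ((wordAct_bijective w).1 e), zero_mul]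
    · simp
  have h3 : platClosure g w.toBraid =
      ∑ z, star (platState g l (wordAct w z)) * platState g l z := by
    rw [platClosure, dotProduct,
      ← Equiv.sum_comp (Equiv.ofBijective _ (wordAct_bijective (g := g) w))]
    exact Finset.sum_congr rfl fun z _ => by
      rw [Equiv.ofBijective_apply, h2]; rfl
  have h4 : ∀ z, star (platState g l (wordAct w z)) * platState g l z =
      ((((fluxDim g : ℝ) ^ l)⁻¹ * (if mirror h z = z then F z else 0) : ℝ) : ℂ) := by
    intro z
    have hs : (1 / √(fluxDim g : ℝ)) ^ l * (1 / √(fluxDim g : ℝ)) ^ l =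
        ((fluxDim g : ℝ) ^ l)⁻¹ := by
      rw [← mul_pow, one_div, ← mul_inv, Real.mul_self_sqrt (Nat.cast_nonneg _), inv_pow]
    rw [platState_eq h, platState_eq h, hF]
    by_cases a : mirror h z = z <;> by_cases b : mirror h (wordAct w z) = wordAct w z
    · simp only [a, b, if_true, mul_one]
      rw [← hs]
      simp
    all_goals simp [a, b]
  rw [h3, Finset.sum_congr rfl fun z _ => h4 z, ← Complex.ofReal_sum, ← Finset.mul_sum, fluxMean]
  change _ = (((∑ x, F (mirror h x)) / _ : ℝ) : ℂ)
  rw [h1]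
  congr 1
  generalize (∑ z, if mirror h z = z then F z else 0) = S
  rw [two_mul, pow_add]
  field_simp

end BraidAction

/-! ### Expectation over coin tosses, reduction modulo `m`, Chebyshev -/

section CoinMean

/-- The expected value of a function of `n` fair coin tosses. -/
noncomputable def coinMean : ℕ → (List Bool → ℝ) → ℝ
  | 0, F => F []
  | n + 1, F => (coinMean n (fun l => F (true :: l)) + coinMean n (fun l => F (false :: l))) / 2

theorem coinMean_congr {n : ℕ} {F F' : List Bool → ℝ} (h : ∀ l, l.length = n → F l = F' l) :
    coinMean n F = coinMean n F' := by
  induction n generalizing F F' with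
  | zero => exact h [] rfl
  | succ n ih =>
    rw [coinMean, coinMean, ih fun l hl => h (true :: l) (by simp [hl]),
      ih fun l hl => h (false :: l) (by simp [hl])]

theorem coinMean_mono {n : ℕ} {F F' : List Bool → ℝ} (h : ∀ l, l.length = n → F l ≤ F' l) :
    coinMean n F ≤ coinMean n F' := by
  induction n generalizing F F' with
  | zero => exact h [] rfl
  | succ n ih =>
    have h1 := ih fun l hl => h (true :: l) (by simp [hl])
    have h2 := ih fun l hl => h (false :: l) (by simp [hl])
    rw [coinMean, coinMean]
    linarith

theorem coinMean_const (n : ℕ) (c : ℝ) : coinMean n (fun _ => c) = c := by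
  induction n with
  | zero => rfl
  | succ n ih => rw [coinMean, ih]; ring

theorem coinMean_add (n : ℕ) (F F' : List Bool → ℝ) :
    coinMean n (fun l => F l + F' l) = coinMean n F + coinMean n F' := by
  induction n generalizing F F' with
  | zero => rfl
  | succ n ih => simp only [coinMean, ih]; ring

theorem coinMean_const_mul (n : ℕ) (c : ℝ) (F : List Bool → ℝ) :
    coinMean n (fun l => c * F l) = c * coinMean n F := by
  induction n generalizing F with
  | zero => rfl
  | succ n ih => simp only [coinMean, ih]; ring

/-- Fubini for coin tosses; all uses of independence below go through this identity. -/
theorem coinMean_append (m n : ℕ) (F : List Bool → ℝ) :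
    coinMean (m + n) F = coinMean m fun l => coinMean n fun l' => F (l ++ l') := by
  induction m generalizing F with
  | zero => rw [Nat.zero_add]; rfl
  | succ m ih => rw [Nat.succ_add, coinMean, coinMean, ih, ih]; rfl

theorem abs_coinMean_sub_le {n : ℕ} {F F' : List Bool → ℝ} {c : ℝ}
    (h : ∀ l, l.length = n → |F l - F' l| ≤ c) : |coinMean n F - coinMean n F'| ≤ c := by
  have h1 := coinMean_mono (n := n) (F := F) (F' := fun l => F' l + c) fun l hl => by
    linarith [(abs_le.1 (h l hl)).2]
  have h2 := coinMean_mono (n := n) (F := F') (F' := fun l => F l + c) fun l hl => by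
    linarith [(abs_le.1 (h l hl)).1]
  rw [coinMean_add, coinMean_const] at h1 h2
  exact abs_le.2 ⟨by linarith, by linarith⟩

theorem sum_ofFn_div (n : ℕ) (F : List Bool → ℝ) :
    (∑ r : Fin n → Bool, F (List.ofFn r)) / 2 ^ n = coinMean n F := by
  induction n generalizing F with
  | zero => simp [coinMean]
  | succ n ih =>
    rw [coinMean, ← ih, ← ih, ← (Fin.consEquiv fun _ : Fin (n + 1) => Bool).sum_comp,
      Fintype.sum_prod_type, Fintype.sum_bool]
    have e : ∀ (b : Bool) (y : Fin n → Bool),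
        F (List.ofFn (Fin.consEquiv (fun _ : Fin (n + 1) => Bool) (b, y))) = F (b :: List.ofFn y) :=
      fun b y => congrArg F (List.ofFn_cons b y)
    simp only [e, pow_succ]
    field_simp

open Classical in
theorem natCard_ofFn_div (n : ℕ) (p : List Bool → Prop) :
    (Nat.card {r : Fin n → Bool // p (List.ofFn r)} : ℝ) / 2 ^ n =
      coinMean n fun l => if p l then 1 else 0 := by
  rw [← sum_ofFn_div, Nat.card_eq_fintype_card, Fintype.card_subtype, Finset.card_filter]
  push_cast
  rfl

/-- The number spelled by `u` followed by binary digits. -/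
def bitsVal (u : ℕ) (l : List Bool) : ℕ := l.foldl (fun v b => 2 * v + b.toNat) u

/-- After the prefix `u`, the `n` further digits reach each number of the interval starting at `u *
2 ^ n` exactly once. The prefix is arbitrary so that the induction can absorb the first digit into
it. -/
theorem coinMean_bitsVal (φ : ℕ → ℝ) (n u : ℕ) :
    coinMean n (fun l => φ (bitsVal u l)) =
      (∑ v ∈ Finset.range (2 ^ n), φ (u * 2 ^ n + v)) / 2 ^ n := by
  induction n generalizing u with
  | zero => simp [coinMean, bitsVal]
  | succ n ih =>
    have h1 := ih (2 * u + 1)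
    have h2 := ih (2 * u)
    simp only [coinMean, bitsVal, List.foldl_cons, Bool.toNat_true, Bool.toNat_false,
      add_zero] at h1 h2 ⊢
    rw [h1, h2, pow_succ 2 n, mul_two (2 ^ n), Finset.sum_range_add]
    have e1 : ∀ v, (2 * u + 1) * 2 ^ n + v = u * (2 ^ n + 2 ^ n) + (2 ^ n + v) := fun v => by ring
    have e2 : ∀ v, 2 * u * 2 ^ n + v = u * (2 ^ n + 2 ^ n) + v := fun v => by ring
    simp only [e1, e2, pow_succ]
    field_simp
    ring

theorem bitsVal_lt (l : List Bool) (u : ℕ) : bitsVal u l < (u + 1) * 2 ^ l.length := by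
  induction l generalizing u with
  | nil => simp [bitsVal]
  | cons b l ih =>
    refine (ih (2 * u + b.toNat)).trans_le ?_
    rw [List.length_cons, pow_succ', ← mul_assoc]
    refine Nat.mul_le_mul_right _ ?_
    have := Bool.toNat_le b
    omega

/-- Among `0, …, Q - 1` the full cycles modulo `m` average correctly; only the incomplete last
cycle, with fewer than `m` terms, causes an error. -/
theorem abs_mean_mod_sub_le {φ : ℕ → ℝ} (h0 : ∀ v, 0 ≤ φ v) (h1 : ∀ v, φ v ≤ 1) {m Q : ℕ}
    (hm : 0 < m) (hQ : 0 < Q) :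
    |(∑ v ∈ Finset.range Q, φ (v % m)) / Q - (∑ v ∈ Finset.range m, φ v) / m| ≤ (m : ℝ) / Q := by
  have key : ∀ q r, r ≤ m → ∑ v ∈ Finset.range (m * q + r), φ (v % m) =
      q * ∑ v ∈ Finset.range m, φ v + ∑ v ∈ Finset.range r, φ v := by
    have hlt : ∀ r, r ≤ m → ∀ q, ∑ v ∈ Finset.range r, φ ((m * q + v) % m) =
        ∑ v ∈ Finset.range r, φ v := fun r hr q =>
      Finset.sum_congr rfl fun v hv => by
        rw [Nat.mul_add_mod, Nat.mod_eq_of_lt ((Finset.mem_range.1 hv).trans_le hr)]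
    intro q r hr
    rw [Finset.sum_range_add, hlt r hr]
    congr 1
    clear hr
    induction q with
    | zero => simp
    | succ q ih => rw [Nat.mul_succ, Finset.sum_range_add, hlt m le_rfl, ih]; push_cast; ring
  have hr : Q % m ≤ m := (Nat.mod_lt _ hm).le
  have hk := key (Q / m) (Q % m) hr
  rw [Nat.div_add_mod] at hk
  rw [hk]
  have hQ' : (Q : ℝ) = m * (Q / m : ℕ) + (Q % m : ℕ) := by exact_mod_cast (Nat.div_add_mod Q m).symm
  have bS : ∀ r, 0 ≤ ∑ v ∈ Finset.range r, φ v ∧ ∑ v ∈ Finset.range r, φ v ≤ r := fun r =>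
    ⟨Finset.sum_nonneg fun v _ => h0 v, by
      simpa using Finset.sum_le_card_nsmul (Finset.range r) φ 1 fun v _ => h1 v⟩
  obtain ⟨s0, s1⟩ := bS m
  obtain ⟨t0, t1⟩ := bS (Q % m)
  have hrR : ((Q % m : ℕ) : ℝ) ≤ m := by exact_mod_cast hr
  generalize ((Q % m : ℕ) : ℝ) = r at *
  generalize ((Q / m : ℕ) : ℝ) = q at *
  generalize ∑ v ∈ Finset.range m, φ v = S at *
  generalize ∑ v ∈ Finset.range (Q % m), φ v = R at *
  have hm' : (0 : ℝ) < m := Nat.cast_pos.2 hm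
  have hQ0 : (0 : ℝ) < Q := Nat.cast_pos.2 hQ
  -- With `Q = m q + r` the full cycles cancel. Both products left in the numerator lie between `0`
  -- and `m²`, because `S ≤ m` and `R ≤ r ≤ m`.
  have e : (q * S + R) / Q - S / m = (m * R - S * r) / (m * Q) := by
    field_simp
    rw [hQ']
    ring
  rw [e, abs_div, abs_of_pos (mul_pos hm' hQ0), div_le_div_iff₀ (mul_pos hm' hQ0) hQ0]
  have : |m * R - S * r| ≤ m * m := abs_le.2 ⟨by nlinarith, by nlinarith⟩
  nlinarith

/-- The sum of the values of `f` on the first `N` blocks of length `M`. -/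
noncomputable def blockSum (M : ℕ) (f : List Bool → ℝ) (N : ℕ) (l : List Bool) : ℝ :=
  ∑ i ∈ Finset.range N, f ((l.drop (i * M)).take M)

theorem blockSum_succ {M : ℕ} (f : List Bool → ℝ) (N : ℕ) {l : List Bool} (l' : List Bool)
    (hl : l.length = M) : blockSum M f (N + 1) (l ++ l') = f l + blockSum M f N l' := by
  rw [blockSum, Finset.sum_range_succ', add_comm, blockSum]
  congr 1
  · rw [Nat.zero_mul, List.drop_zero, List.take_left' hl]
  · refine Finset.sum_congr rfl fun i _ => ?_
    rw [Nat.succ_mul, Nat.add_comm, ← List.drop_drop, List.drop_left' hl]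

theorem blockSum_append {M : ℕ} (f : List Bool → ℝ) {N : ℕ} {l : List Bool} (l' : List Bool)
    (hl : l.length = N * M) : blockSum M f N (l ++ l') = blockSum M f N l := by
  refine Finset.sum_congr rfl fun i hi => ?_
  have : (i + 1) * M ≤ N * M := Nat.mul_le_mul_right _ (Finset.mem_range.1 hi)
  rw [Nat.succ_mul] at this
  rw [List.drop_append_of_le_length (by omega), List.take_append_of_le_length
    (by rw [List.length_drop]; omega)]

theorem coinMean_blockSum (M : ℕ) (f : List Bool → ℝ) (N : ℕ) :
    coinMean (N * M) (blockSum M f N) = N * coinMean M f := by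
  induction N with
  | zero => simp [blockSum, coinMean]
  | succ N ih =>
    rw [Nat.succ_mul, Nat.add_comm, coinMean_append, coinMean_congr (F' := fun l =>
      f l + N * coinMean M f), coinMean_add, coinMean_const]
    · push_cast; ring
    · intro l hl
      simp only [blockSum_succ f N _ hl]
      rw [coinMean_add, coinMean_const, ih]

/-- Variances of independent blocks add up: the cross term contains the centred sum of the later
blocks, whose mean is zero. -/
theorem coinMean_blockSum_sq (M : ℕ) (f : List Bool → ℝ) (N : ℕ) :
    coinMean (N * M) (fun l => (blockSum M f N l - N * coinMean M f) ^ 2) =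
      N * coinMean M fun l => (f l - coinMean M f) ^ 2 := by
  induction N with
  | zero => simp [blockSum, coinMean]
  | succ N ih =>
    set μ := coinMean M f with hμ
    rw [Nat.succ_mul, Nat.add_comm, coinMean_append, coinMean_congr (F' := fun l =>
      (f l - μ) ^ 2 + N * coinMean M fun l => (f l - μ) ^ 2), coinMean_add, coinMean_const]
    · push_cast; ring
    · intro l hl
      -- The first block is fixed and the square is expanded into a linear term, a constant and the
      -- centred square of the remaining blocks.
      rw [← ih, coinMean_congr (n := N * M) (F' := fun l' => (2 * (f l - μ)) * blockSum M f N l' +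
        (((f l - μ) ^ 2 - 2 * (f l - μ) * (N * μ)) + (blockSum M f N l' - N * μ) ^ 2)),
        coinMean_add, coinMean_add, coinMean_const, coinMean_const_mul, coinMean_blockSum]
      · ring
      · intro l' _
        rw [blockSum_succ f N _ hl]
        push_cast
        ring

/-- Since `f ^ 2 ≤ f`, the variance is at most `μ - μ ^ 2`, which never exceeds `1 / 4`. -/
theorem coinMean_sub_sq_le {M : ℕ} {f : List Bool → ℝ} (h0 : ∀ l, 0 ≤ f l) (h1 : ∀ l, f l ≤ 1) :
    (coinMean M fun l => (f l - coinMean M f) ^ 2) ≤ 1 / 4 := by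
  set μ := coinMean M f with hμ
  have h : (coinMean M fun l => (f l - μ) ^ 2) ≤ coinMean M fun l => (1 - 2 * μ) * f l + μ ^ 2 :=
    coinMean_mono fun l _ => by nlinarith [h0 l, h1 l]
  rw [coinMean_add, coinMean_const_mul, coinMean_const, ← hμ] at h
  nlinarith [sq_nonneg (μ - 1 / 2)]

open Classical in
/-- Chebyshev's inequality for the average over independent blocks of coin tosses. -/
theorem coinMean_blockSum_tail {M : ℕ} {f : List Bool → ℝ} (h0 : ∀ l, 0 ≤ f l)
    (h1 : ∀ l, f l ≤ 1) {N T : ℕ} (hT : N * M ≤ T) {δ : ℝ} (hδ : 0 < δ) (hN : 0 < N) :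
    (coinMean T fun l => if δ < |blockSum M f N l / N - coinMean M f| then 1 else 0) ≤
      1 / (4 * N * δ ^ 2) := by
  obtain ⟨c, rfl⟩ := Nat.exists_eq_add_of_le hT
  have hN' : (0 : ℝ) < N := Nat.cast_pos.2 hN
  -- The tosses after the first `N * M` do not enter the event and are averaged out.
  rw [coinMean_append, coinMean_congr (n := N * M) (F' := fun l =>
    if δ < |blockSum M f N l / N - coinMean M f| then 1 else 0)]
  · have hle : (coinMean (N * M) fun l =>
        if δ < |blockSum M f N l / N - coinMean M f| then (1 : ℝ) else 0) ≤
        coinMean (N * M) fun l =>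
          (1 / (N * δ) ^ 2) * (blockSum M f N l - N * coinMean M f) ^ 2 := by
      refine coinMean_mono fun l _ => ?_
      split_ifs with h
      · have e : blockSum M f N l - N * coinMean M f =
            N * (blockSum M f N l / N - coinMean M f) := by field_simp
        rw [e, one_div, inv_mul_eq_div, le_div_iff₀ (by positivity), one_mul, mul_pow, mul_pow]
        have := pow_le_pow_left₀ hδ.le h.le 2
        rw [sq_abs] at this
        gcongr
      · positivity
    refine hle.trans ?_
    rw [coinMean_const_mul, coinMean_blockSum_sq]
    calc 1 / (N * δ) ^ 2 * (N * coinMean M fun l => (f l - coinMean M f) ^ 2)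
        ≤ 1 / (N * δ) ^ 2 * (N * (1 / 4)) := by gcongr; exact coinMean_sub_sq_le h0 h1
      _ = 1 / (4 * N * δ ^ 2) := by field_simp
  · intro l hl
    simp only [blockSum_append f _ hl, coinMean_const]

end CoinMean

/-! ### Nearly uniform random fluxes -/

section Sampling

variable {G : Type u} [Group G] [Fintype G] (lab : G ≃ Fin (Fintype.card G)) (g : G)

/-- The group element chosen by a list of coin tosses. -/
noncomputable def drawElt (l : List Bool) : G :=
  lab.symm ⟨bitsVal 0 l % Fintype.card G, Nat.mod_lt _ Fintype.card_pos⟩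

/-- The flux chosen by a list of coin tosses. -/
noncomputable def drawFlux (l : List Bool) : FluxClass g :=
  FluxClass.conj (drawElt lab l) ⟨g, IsConj.refl g⟩

/-- The flux configuration chosen by blocks of `K` coin tosses. -/
noncomputable def drawConfig (K n : ℕ) (l : List Bool) : Fin n → FluxClass g := fun j =>
  drawFlux lab g ((l.drop (j * K)).take K)

variable {g} in
-- Double counting over pairs `(y, h)`: by transitivity and right translation the sum over `h` does
-- not depend on `y`, and since conjugation by `h` permutes the class, the sum over `y` does not
-- depend on `h`.
theorem sum_conj_div (ψ : FluxClass g → ℝ) (x : FluxClass g) :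
    (∑ h : G, ψ (x.conj h)) / Fintype.card G = (∑ y, ψ y) / fluxDim g := by
  have h1 : ∀ y : FluxClass g, ∑ h : G, ψ (y.conj h) = ∑ h : G, ψ (x.conj h) := by
    intro y
    obtain ⟨k, hk⟩ := isConj_iff.1 (x.2.symm.trans y.2)
    have : y = x.conj k := FluxClass.ext_elt hk.symm
    rw [this, ← Equiv.sum_comp (Equiv.mulRight k) (fun h => ψ (x.conj h))]
    simp [FluxClass.conj_conj]
  have h2 : ∀ h : G, ∑ y : FluxClass g, ψ (y.conj h) = ∑ y, ψ y := by
    intro h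
    refine Equiv.sum_comp (⟨FluxClass.conj h, FluxClass.conj h⁻¹, fun y => ?_, fun y => ?_⟩ :
      FluxClass g ≃ FluxClass g) ψ <;> simp [FluxClass.conj_conj]
  have h3 : ∑ y : FluxClass g, ∑ h : G, ψ (y.conj h) = ∑ h : G, ∑ y : FluxClass g, ψ (y.conj h) :=
    Finset.sum_comm
  simp only [h1, h2, Finset.sum_const, Finset.card_univ, nsmul_eq_mul] at h3
  have hd : (Fintype.card (FluxClass g) : ℝ) ≠ 0 := Nat.cast_ne_zero.2 (fluxDim_pos (g := g)).ne'
  have hG : (Fintype.card G : ℝ) ≠ 0 := Nat.cast_ne_zero.2 Fintype.card_ne_zero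
  rw [fluxDim, div_eq_div_iff hG hd]
  linarith

theorem abs_coinMean_drawFlux_sub_le {ψ : FluxClass g → ℝ} (h0 : ∀ x, 0 ≤ ψ x)
    (h1 : ∀ x, ψ x ≤ 1) (K : ℕ) :
    |coinMean K (fun l => ψ (drawFlux lab g l)) - (∑ x, ψ x) / fluxDim g| ≤
      (Fintype.card G : ℝ) / 2 ^ K := by
  set x₀ : FluxClass g := ⟨g, IsConj.refl g⟩
  set φ : ℕ → ℝ := fun v => ψ (x₀.conj
    (lab.symm ⟨v % Fintype.card G, Nat.mod_lt _ Fintype.card_pos⟩)) with hφ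
  have e1 : coinMean K (fun l => ψ (drawFlux lab g l)) =
      (∑ v ∈ Finset.range (2 ^ K), φ (v % Fintype.card G)) / (2 ^ K : ℕ) := by
    have := coinMean_bitsVal φ K 0
    simp only [Nat.zero_mul, Nat.zero_add] at this
    simp only [hφ, Nat.mod_mod, Nat.cast_pow, Nat.cast_ofNat] at this ⊢
    exact this
  have e2 : (∑ x, ψ x) / fluxDim g =
      (∑ v ∈ Finset.range (Fintype.card G), φ v) / Fintype.card G := by
    rw [← sum_conj_div ψ x₀, Finset.sum_range, ← Equiv.sum_comp lab]
    simp only [hφ, Nat.mod_eq_of_lt (Fin.is_lt _), Fin.eta, Equiv.symm_apply_apply]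
  rw [e1, e2]
  have := abs_mean_mod_sub_le (φ := φ) (fun v => h0 _) (fun v => h1 _)
    (m := Fintype.card G) Fintype.card_pos (Nat.two_pow_pos K)
  simpa using this

variable {g} in
theorem fluxMean_succ (n : ℕ) (f : (Fin (n + 1) → FluxClass g) → ℝ) :
    fluxMean g (n + 1) f = (∑ x, fluxMean g n fun y => f (Fin.cons x y)) / fluxDim g := by
  simp only [fluxMean]
  rw [← (Fin.consEquiv fun _ : Fin (n + 1) => FluxClass g).sum_comp, Fintype.sum_prod_type,
    ← Finset.sum_div, div_div, pow_succ]
  rfl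

theorem drawConfig_append {K : ℕ} (n : ℕ) {l : List Bool} (l' : List Bool) (hl : l.length = K) :
    drawConfig lab g K (n + 1) (l ++ l') =
      Fin.cons (drawFlux lab g l) (drawConfig lab g K n l') := by
  funext j
  refine Fin.cases ?_ (fun j => ?_) j
  · simp [drawConfig, List.take_left' hl]
  · simp only [drawConfig, Fin.val_succ, Fin.cons_succ]
    rw [Nat.succ_mul, Nat.add_comm, ← List.drop_drop, List.drop_left' hl]

/-- A hybrid argument: the strands are replaced by uniform ones one at a time. A partial average of
`f` stays between `0` and `1`, so each replacement costs at most the error of a single flux. -/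
theorem abs_coinMean_drawConfig_sub_le (K n : ℕ) {f : (Fin n → FluxClass g) → ℝ}
    (h0 : ∀ x, 0 ≤ f x) (h1 : ∀ x, f x ≤ 1) :
    |coinMean (n * K) (fun l => f (drawConfig lab g K n l)) - fluxMean g n f| ≤
      n * ((Fintype.card G : ℝ) / 2 ^ K) := by
  induction n with
  | zero =>
    have : drawConfig lab g K 0 [] = default := Subsingleton.elim _ _
    simp [coinMean, fluxMean, this]
  | succ n ih =>
    have hd : (0 : ℝ) < fluxDim g := Nat.cast_pos.2 fluxDim_pos
    set ψ : FluxClass g → ℝ := fun x => fluxMean g n fun y => f (Fin.cons x y) with hψ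
    have p0 : ∀ x, 0 ≤ ψ x := fun x =>
      div_nonneg (Finset.sum_nonneg fun y _ => h0 _) (by positivity)
    have p1 : ∀ x, ψ x ≤ 1 := fun x => by
      refine div_le_one_of_le₀ ?_ (by positivity)
      have := Finset.sum_le_card_nsmul Finset.univ (fun y => f (Fin.cons x y)) 1 fun y _ => h1 _
      simpa [fluxDim] using this
    rw [Nat.succ_mul, Nat.add_comm, coinMean_append, fluxMean_succ]
    have a1 := abs_coinMean_drawFlux_sub_le lab g p0 p1 K
    have a2 : |(coinMean K fun l => coinMean (n * K) fun l' =>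
        f (drawConfig lab g K (n + 1) (l ++ l'))) - coinMean K fun l => ψ (drawFlux lab g l)| ≤
        n * ((Fintype.card G : ℝ) / 2 ^ K) := by
      refine abs_coinMean_sub_le fun l hl => ?_
      simp only [drawConfig_append lab g n _ hl]
      exact ih (fun _ => h0 _) (fun _ => h1 _)
    refine (abs_sub_le _ _ _).trans ((add_le_add a2 a1).trans (le_of_eq ?_))
    push_cast
    ring

end Sampling

/-! ### Time-bounded program logic and determinism -/

section Reach

/-- The number of nodes of an expression. -/
def RExpr.nodes : RExpr → ℕ
  | const _ => 1
  | reg _ => 1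
  | get _ e => e.nodes + 1
  | add e f => e.nodes + f.nodes + 1
  | sub e f => e.nodes + f.nodes + 1
  | mul e f => e.nodes + f.nodes + 1
  | div e f => e.nodes + f.nodes + 1
  | mod e f => e.nodes + f.nodes + 1
  | lt e f => e.nodes + f.nodes + 1
  | eq e f => e.nodes + f.nodes + 1
  | gmul e f => e.nodes + f.nodes + 1
  | ginv e => e.nodes + 1

/-- All values that occur in the evaluation of an expression have at most `L` bits. -/
def RExpr.Fits (tab : GroupTables) (L : ℕ) (s : RState) : RExpr → Prop
  | const c => c < 2 ^ L
  | reg x => s.reg x < 2 ^ L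
  | get a e => e.Fits tab L s ∧ (get a e).eval tab s < 2 ^ L
  | add e f => e.Fits tab L s ∧ f.Fits tab L s ∧ (add e f).eval tab s < 2 ^ L
  | sub e f => e.Fits tab L s ∧ f.Fits tab L s ∧ (sub e f).eval tab s < 2 ^ L
  | mul e f => e.Fits tab L s ∧ f.Fits tab L s ∧ (mul e f).eval tab s < 2 ^ L
  | div e f => e.Fits tab L s ∧ f.Fits tab L s ∧ (div e f).eval tab s < 2 ^ L
  | mod e f => e.Fits tab L s ∧ f.Fits tab L s ∧ (mod e f).eval tab s < 2 ^ L
  | lt e f => e.Fits tab L s ∧ f.Fits tab L s ∧ (lt e f).eval tab s < 2 ^ L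
  | eq e f => e.Fits tab L s ∧ f.Fits tab L s ∧ (eq e f).eval tab s < 2 ^ L
  | gmul e f => e.Fits tab L s ∧ f.Fits tab L s ∧ (gmul e f).eval tab s < 2 ^ L
  | ginv e => e.Fits tab L s ∧ (ginv e).eval tab s < 2 ^ L

variable {tab : GroupTables} {L : ℕ}

theorem RExpr.Fits.cost_le {s : RState} {e : RExpr} (h : e.Fits tab L s) :
    e.cost tab s ≤ e.nodes * (L + 1) := by
  induction e with
  | const c => simpa [cost, nodes] using Nat.size_le.2 h
  | reg x => simpa [cost, nodes] using Nat.size_le.2 h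
  | get a e ih =>
    have := Nat.size_le.2 h.2
    have := ih h.1
    simp only [cost, nodes, add_mul]; omega
  | ginv e ih =>
    have := Nat.size_le.2 h.2
    have := ih h.1
    simp only [cost, nodes, add_mul]; omega
  | _ e f ihe ihf =>
    have := Nat.size_le.2 h.2.2
    have := ihe h.1
    have := ihf h.2.1
    simp only [cost, nodes, add_mul]; omega

/-- Started in the state `s`, the program `P` halts within `T` units of time in a state with the
property `Q`. -/
def Reach (tab : GroupTables) (P : RProg) (T : ℕ) (s : RState) (Q : RState → Prop) : Prop :=
  ∃ (s' : RState) (t : ℕ), Exec tab P s s' t ∧ t ≤ T ∧ Q s'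

namespace Reach

theorem mono {P : RProg} {T T' : ℕ} {s : RState} {Q Q' : RState → Prop} (h : Reach tab P T s Q)
    (hT : T ≤ T') (hQ : ∀ s', Q s' → Q' s') : Reach tab P T' s Q' := by
  obtain ⟨s', t, h1, h2, h3⟩ := h
  exact ⟨s', t, h1, h2.trans hT, hQ s' h3⟩

theorem mono_time {P : RProg} {T T' : ℕ} {s : RState} {Q : RState → Prop} (h : Reach tab P T s Q)
    (hT : T ≤ T') : Reach tab P T' s Q := h.mono hT fun _ h => h

/-- The value is a separate parameter `v`, so that the state after the step mentions the intended
mathematical value and not the expression. -/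
theorem assign {x v : ℕ} {e : RExpr} {s : RState} {Q : RState → Prop}
    (he : e.Fits tab L s ∧ e.eval tab s = v) (hQ : Q (s.setReg x v)) :
    Reach tab (.assign x e) (e.nodes * (L + 1) + 1) s Q :=
  ⟨_, _, .assign x e s, Nat.succ_le_succ he.1.cost_le, he.2.symm ▸ hQ⟩

theorem store {a i v : ℕ} {e f : RExpr} {s : RState} {Q : RState → Prop}
    (he : e.Fits tab L s ∧ e.eval tab s = i) (hf : f.Fits tab L s ∧ f.eval tab s = v)
    (hQ : Q (s.setArr a i v)) :
    Reach tab (.store a e f) ((e.nodes + f.nodes) * (L + 1) + 1) s Q :=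
  ⟨_, _, .store a e f s,
    by rw [add_mul]; exact Nat.succ_le_succ (add_le_add he.1.cost_le hf.1.cost_le),
    he.2.symm ▸ hf.2.symm ▸ hQ⟩

theorem coin {x : ℕ} {b : Bool} {l : List Bool} {s : RState} {Q : RState → Prop}
    (h : s.coins = b :: l) (hQ : Q ((s.setReg x b.toNat).setCoins l)) :
    Reach tab (.coin x) 1 s Q :=
  ⟨_, _, .coin x b l s h, le_rfl, hQ⟩

theorem seq {P P' : RProg} {T T' : ℕ} {s : RState} {Q : RState → Prop}
    (h : Reach tab P T s fun s' => Reach tab P' T' s' Q) :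
    Reach tab (.seq P P') (T + T' + 1) s Q := by
  obtain ⟨s', t, h1, h2, s'', t', h3, h4, h5⟩ := h
  exact ⟨s'', _, .seq h1 h3, by omega, h5⟩

theorem assign_seq {x v : ℕ} {e : RExpr} {P : RProg} {T : ℕ} {s : RState} {Q : RState → Prop}
    (he : e.Fits tab L s ∧ e.eval tab s = v) (h : Reach tab P T (s.setReg x v) Q) :
    Reach tab (.seq (.assign x e) P) (e.nodes * (L + 1) + 1 + T + 1) s Q :=
  seq (assign he h)

theorem store_seq {a i v : ℕ} {e f : RExpr} {P : RProg} {T : ℕ} {s : RState} {Q : RState → Prop}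
    (he : e.Fits tab L s ∧ e.eval tab s = i) (hf : f.Fits tab L s ∧ f.eval tab s = v)
    (h : Reach tab P T (s.setArr a i v) Q) :
    Reach tab (.seq (.store a e f) P) ((e.nodes + f.nodes) * (L + 1) + 1 + T + 1) s Q :=
  seq (store he hf h)

theorem ite_pos {e : RExpr} {P P' : RProg} {T : ℕ} {s : RState} {Q : RState → Prop}
    (he : e.Fits tab L s ∧ e.eval tab s ≠ 0) (h : Reach tab P T s Q) :
    Reach tab (.ite e P P') (e.nodes * (L + 1) + T + 1) s Q := by
  obtain ⟨s', t, h3, h4, h5⟩ := h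
  have := he.1.cost_le
  exact ⟨s', _, .ite_true he.2 h3, by omega, h5⟩

theorem ite_neg {e : RExpr} {P P' : RProg} {T : ℕ} {s : RState} {Q : RState → Prop}
    (he : e.Fits tab L s ∧ e.eval tab s = 0) (h : Reach tab P' T s Q) :
    Reach tab (.ite e P P') (e.nodes * (L + 1) + T + 1) s Q := by
  obtain ⟨s', t, h3, h4, h5⟩ := h
  have := he.1.cost_le
  exact ⟨s', _, .ite_false he.2 h3, by omega, h5⟩

/-- The invariant is indexed by the number of completed rounds; since exactly `N` rounds take place,
it yields termination and the time bound as well. -/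
theorem loop {e : RExpr} {P : RProg} {B : ℕ} (Inv : ℕ → RState → Prop) (N : ℕ) {s : RState}
    (h0 : Inv 0 s) (hend : ∀ s, Inv N s → e.Fits tab L s ∧ e.eval tab s = 0)
    (hstep : ∀ j < N, ∀ s, Inv j s →
      (e.Fits tab L s ∧ e.eval tab s ≠ 0) ∧ Reach tab P B s (Inv (j + 1))) :
    Reach tab (.loop e P) (N * (B + e.nodes * (L + 1) + 1) + e.nodes * (L + 1) + 1) s
      (Inv N) := by
  suffices h : ∀ d j, j + d = N → ∀ s, Inv j s →
      Reach tab (.loop e P) (d * (B + e.nodes * (L + 1) + 1) + e.nodes * (L + 1) + 1) s (Inv N) from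
    h N 0 (Nat.zero_add N) s h0
  intro d
  induction d with
  | zero =>
    rintro j rfl s hs
    have := (hend s hs).1.cost_le
    exact ⟨s, _, .loop_false (hend s hs).2, by omega, hs⟩
  | succ d ih =>
    intro j hj s hs
    obtain ⟨⟨h1, h2⟩, s', t, h3, h4, h5⟩ := hstep j (by omega) s hs
    obtain ⟨s'', t', h6, h7, h8⟩ := ih (j + 1) (by omega) s' h5
    have := h1.cost_le
    exact ⟨s'', _, .loop_true h2 h3 h6, by rw [Nat.succ_mul]; omega, h8⟩

end Reach

/-- The bad event in `ApproximatesWithin` speaks of some run with a bad output. Determinism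
identifies this run with the one constructed by the program logic. -/
theorem Exec.unique {P : RProg} {s s₁ s₂ : RState} {t₁ t₂ : ℕ} (h₁ : Exec tab P s s₁ t₁)
    (h₂ : Exec tab P s s₂ t₂) : s₁ = s₂ := by
  induction h₁ generalizing s₂ t₂ with
  | coin x b l s h =>
    cases h₂ with
    | coin _ b' l' _ h' =>
      rw [h] at h'
      cases h'
      rfl
  | seq _ _ ihP ihQ =>
    cases h₂ with
    | seq hP hQ => cases ihP hP; exact ihQ hQ
  | ite_true he _ ih =>
    cases h₂ with
    | ite_true _ hP => exact ih hP
    | ite_false he' _ => exact absurd he' he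
  | ite_false he _ ih =>
    cases h₂ with
    | ite_true he' _ => exact absurd he he'
    | ite_false _ hP => exact ih hP
  | loop_true he _ _ ihP ihL =>
    cases h₂ with
    | loop_true _ hP hL => cases ihP hP; exact ihL hL
    | loop_false he' => exact absurd he' he
  | loop_false he =>
    cases h₂ with
    | loop_true he' _ _ => exact absurd he he'
    | loop_false _ => rfl
  | _ => cases h₂; rfl

end Reach

/-! ### What programs leave untouched, and how fluxes are stored -/

section State

@[simp] theorem RState.reg_setReg (s : RState) (x v : ℕ) :
    (s.setReg x v).reg = Function.update s.reg x v := rfl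

@[simp] theorem RState.arr_setReg (s : RState) (x v : ℕ) : (s.setReg x v).arr = s.arr := rfl

@[simp] theorem RState.coins_setReg (s : RState) (x v : ℕ) : (s.setReg x v).coins = s.coins := rfl

@[simp] theorem RState.reg_setArr (s : RState) (a i v : ℕ) : (s.setArr a i v).reg = s.reg := rfl

@[simp] theorem RState.arr_setArr (s : RState) (a i v : ℕ) :
    (s.setArr a i v).arr = Function.update s.arr a (Function.update (s.arr a) i v) := rfl

@[simp] theorem RState.coins_setArr (s : RState) (a i v : ℕ) :
    (s.setArr a i v).coins = s.coins := rfl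

@[simp] theorem RState.reg_setCoins (s : RState) (l : List Bool) : (s.setCoins l).reg = s.reg := rfl

@[simp] theorem RState.arr_setCoins (s : RState) (l : List Bool) : (s.setCoins l).arr = s.arr := rfl

@[simp] theorem RState.coins_setCoins (s : RState) (l : List Bool) : (s.setCoins l).coins = l := rfl

/-- The registers below `b` and the braid word are the same in two states. -/
structure Frame (b : ℕ) (s s' : RState) : Prop where
  reg : ∀ r < b, s'.reg r = s.reg r
  arr_zero : s'.arr 0 = s.arr 0
  arr_one : s'.arr 1 = s.arr 1

theorem Frame.refl (b : ℕ) (s : RState) : Frame b s s := ⟨fun _ _ => rfl, rfl, rfl⟩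

theorem Frame.trans {b c : ℕ} {s s' s'' : RState} (h : Frame b s s') (h' : Frame c s' s'')
    (hc : b ≤ c) : Frame b s s'' :=
  ⟨fun r hr => (h'.reg r (hr.trans_le hc)).trans (h.reg r hr), h'.arr_zero.trans h.arr_zero,
    h'.arr_one.trans h.arr_one⟩

theorem frame_setReg_iff {b x v : ℕ} {s s' : RState} (hx : b ≤ x) :
    Frame b s (s'.setReg x v) ↔ Frame b s s' := by
  have h : ∀ r < b, (s'.setReg x v).reg r = s'.reg r := fun r hr => by
    simp [(hr.trans_le hx).ne]
  exact ⟨fun hf => ⟨fun r hr => (h r hr).symm.trans (hf.reg r hr), hf.arr_zero, hf.arr_one⟩,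
    fun hf => ⟨fun r hr => (h r hr).trans (hf.reg r hr), hf.arr_zero, hf.arr_one⟩⟩

theorem frame_setArr_iff {b a i v : ℕ} {s s' : RState} (ha : 2 ≤ a) :
    Frame b s (s'.setArr a i v) ↔ Frame b s s' := by
  have h0 : (s'.setArr a i v).arr 0 = s'.arr 0 := by simp [show (0 : ℕ) ≠ a by omega]
  have h1 : (s'.setArr a i v).arr 1 = s'.arr 1 := by simp [show (1 : ℕ) ≠ a by omega]
  exact ⟨fun hf => ⟨hf.reg, h0.symm.trans hf.arr_zero, h1.symm.trans hf.arr_one⟩,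
    fun hf => ⟨hf.reg, h0.trans hf.arr_zero, h1.trans hf.arr_one⟩⟩

theorem frame_setCoins_iff {b : ℕ} {l : List Bool} {s s' : RState} :
    Frame b s (s'.setCoins l) ↔ Frame b s s' :=
  ⟨fun h => ⟨h.reg, h.arr_zero, h.arr_one⟩, fun h => ⟨h.reg, h.arr_zero, h.arr_one⟩⟩

variable {G : Type u} [Group G] [Fintype G] (lab : G ≃ Fin (Fintype.card G)) {g : G} {n : ℕ}

set_option linter.unusedSectionVars false

/-- The input registers and the braid word are intact. -/
structure InputHeld (g : G) (w : BraidWord n) (k : ℕ) (s : RState) : Prop where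
  card : s.reg 0 = Fintype.card G
  elt : s.reg 1 = lab g
  strands : s.reg 2 = n
  length : s.reg 3 = w.length
  accuracy : s.reg 4 = k
  index : ∀ (j : ℕ) (h : j < w.length), s.arr 0 j = (w[j].1 : ℕ)
  sign : ∀ (j : ℕ) (h : j < w.length), s.arr 1 j = w[j].2.toNat

variable {lab}

theorem InputHeld.frame {w : BraidWord n} {k b : ℕ} {s s' : RState}
    (h : InputHeld lab g w k s) (hf : Frame b s s') (hb : 5 ≤ b) : InputHeld lab g w k s' where
  card := (hf.reg 0 (by omega)).trans h.card
  elt := (hf.reg 1 (by omega)).trans h.elt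
  strands := (hf.reg 2 (by omega)).trans h.strands
  length := (hf.reg 3 (by omega)).trans h.length
  accuracy := (hf.reg 4 (by omega)).trans h.accuracy
  index j hj := by rw [hf.arr_zero]; exact h.index j hj
  sign j hj := by rw [hf.arr_one]; exact h.sign j hj

variable (lab)

/-- The array `A` holds the labels of the flux configuration `x`. -/
def HoldsConfig (x : Fin n → FluxClass g) (A : ℕ → ℕ) : Prop :=
  ∀ j : Fin n, A j = lab (x j).elt

@[simp] theorem groupTables_mul (a b : G) :
    (groupTables lab).mul (lab a) (lab b) = lab (a * b) := by
  simp [groupTables]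

@[simp] theorem groupTables_inv (a : G) : (groupTables lab).inv (lab a) = lab a⁻¹ := by
  simp [groupTables]

end State

/-! ### Correctness and cost of the deterministic subroutines -/

section Programs

variable {G : Type u} [Group G] [Fintype G] {lab : G ≃ Fin (Fintype.card G)} {g : G} {n : ℕ}
  {w : BraidWord n} {k L : ℕ}

/-- Run `P` with register `c` ranging over the numbers less than the content of register `b`. -/
def forProg (c b : ℕ) (P : RProg) : RProg :=
  .seq (.assign c (.const 0)) <| .loop (.lt (.reg c) (.reg b)) <|
  .seq P (.assign c (.add (.reg c) (.const 1)))

/-- The invariant must not depend on the counter, which is overwritten outside the body. The summand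
`12 * (L + 1)` generously covers the test and the increment, as do the round constants in the later
bounds. -/
theorem reach_forProg {tab : GroupTables} {c b N B : ℕ} {P : RProg} (hcb : b ≠ c) (hN : N < 2 ^ L)
    (Inv : ℕ → RState → Prop) {s : RState}
    (hInv : ∀ j s v, Inv j s → Inv j (s.setReg c v)) (hb : s.reg b = N) (h0 : Inv 0 s)
    (hstep : ∀ j < N, ∀ s, Inv j s → s.reg c = j → s.reg b = N →
      Reach tab P B s fun s' => Inv (j + 1) s' ∧ s'.reg c = j ∧ s'.reg b = N) :
    Reach tab (forProg c b P) (N * (B + 12 * (L + 1)) + 12 * (L + 1)) s (Inv N) := by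
  refine Reach.mono (Reach.assign_seq (L := L) (v := 0) ?_ <|
    Reach.loop (L := L) (B := B + 6 * (L + 1))
      (fun j s' => Inv j s' ∧ s'.reg c = j ∧ s'.reg b = N) N ?_ ?_ ?_)
    (T' := N * (B + 12 * (L + 1)) + 12 * (L + 1)) ?_ fun s' hs' => hs'.1
  · simp [RExpr.Fits, RExpr.eval]
  · exact ⟨hInv 0 s 0 h0, by simp, by simpa [hcb] using hb⟩
  · rintro s ⟨-, h1, h2⟩
    simp [RExpr.Fits, RExpr.eval, h1, h2, hN]
  · rintro j hj s ⟨hs, h1, h2⟩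
    have hj1 : j + 1 < 2 ^ L := by omega
    have hj0 : j < 2 ^ L := by omega
    have hL : L ≠ 0 := by rintro rfl; simp at hj1
    refine ⟨by simp [RExpr.Fits, RExpr.eval, h1, h2, hj, hN, hj0, hL], Reach.mono_time
      (Reach.seq ((hstep j hj s hs h1 h2).mono le_rfl ?_)) (T := B + (3 * (L + 1) + 1) + 1)
      (by omega)⟩
    rintro s' ⟨hs', h1', h2'⟩
    refine Reach.assign (L := L) (v := j + 1) ?_ ⟨hInv _ _ _ hs', by simp, by simpa [hcb] using h2'⟩
    simp [RExpr.Fits, RExpr.eval, h1', hj0, hj1, hL]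
  · simp only [RExpr.nodes]
    have h : N * (B + 6 * (L + 1) + (1 + 1 + 1) * (L + 1) + 1) ≤ N * (B + 12 * (L + 1)) :=
      Nat.mul_le_mul_left _ (by omega)
    omega

/-- Act with the braid word on the configuration in array `2`. -/
def braidProg : RProg :=
  .seq (.assign 10 (.reg 3)) <| .loop (.reg 10) <|
  .seq (.assign 10 (.sub (.reg 10) (.const 1))) <|
  .seq (.assign 11 (.get 0 (.reg 10))) <|
  .seq (.assign 12 (.get 2 (.reg 11))) <|
  .seq (.assign 13 (.get 2 (.add (.reg 11) (.const 1)))) <|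
  .ite (.get 1 (.reg 10))
    (.seq (.store 2 (.reg 11) (.reg 13))
      (.store 2 (.add (.reg 11) (.const 1)) (.gmul (.gmul (.reg 13) (.reg 12)) (.ginv (.reg 13)))))
    (.seq (.store 2 (.reg 11) (.gmul (.gmul (.ginv (.reg 12)) (.reg 13)) (.reg 12)))
      (.store 2 (.add (.reg 11) (.const 1)) (.reg 12)))

set_option linter.unusedSectionVars false

theorem lab_lt {L : ℕ} (hG : Fintype.card G < 2 ^ L) (a : G) : (lab a : ℕ) < 2 ^ L :=
  (lab a).2.trans hG

theorem HoldsConfig.update {x : Fin n → FluxClass g} {A : ℕ → ℕ} (h : HoldsConfig lab x A)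
    (i : Fin n) (y : FluxClass g) {v : ℕ} (hv : v = lab y.elt) :
    HoldsConfig lab (Function.update x i y) (Function.update A i v) := by
  intro j
  by_cases hj : j = i
  · subst hj; simp [hv]
  · simpa [hj, Fin.val_inj] using h j

/-- This is the shape of the two stores made by `braidProg`; both new values refer to the old
configuration. -/
theorem crossFlux_eq_update (i : Fin (n - 1)) (x : Fin n → FluxClass g) :
    crossFlux i x = Function.update (Function.update x (leftStrand i) (x (rightStrand i)))
      (rightStrand i) ((x (leftStrand i)).conj (x (rightStrand i)).elt) := by
  have h := leftStrand_ne_rightStrand i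
  funext k
  by_cases h1 : k = leftStrand i <;> by_cases h2 : k = rightStrand i <;>
    simp_all [crossFlux, Ne.symm h]

theorem uncrossFlux_eq_update (i : Fin (n - 1)) (x : Fin n → FluxClass g) :
    uncrossFlux i x = Function.update (Function.update x (leftStrand i)
      ((x (rightStrand i)).conj (x (leftStrand i)).elt⁻¹)) (rightStrand i) (x (leftStrand i)) := by
  have h := leftStrand_ne_rightStrand i
  funext k
  by_cases h1 : k = leftStrand i <;> by_cases h2 : k = rightStrand i <;>
    simp_all [uncrossFlux, Ne.symm h]

/-- The last letter acts first, so register `10` counts down, and after `j` rounds the last `j`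
letters have acted. Registers `12` and `13` save both old fluxes before either cell is overwritten.
-/
theorem reach_braidProg (hG : Fintype.card G < 2 ^ L) (hn : n < 2 ^ L) (hm : w.length < 2 ^ L)
    {s : RState} (hs : InputHeld lab g w k s) {x : Fin n → FluxClass g}
    (hx : HoldsConfig lab x (s.arr 2)) :
    Reach (groupTables lab) braidProg (w.length * (60 * (L + 1)) + 20 * (L + 1)) s fun s' =>
      Frame 9 s s' ∧ s'.reg 9 = s.reg 9 ∧ s'.coins = s.coins ∧ s'.arr 3 = s.arr 3 ∧
        HoldsConfig lab (wordAct w x) (s'.arr 2) := by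
  have hlab := lab_lt (lab := lab) hG
  have h1 : 1 < 2 ^ L := lt_of_le_of_lt Fintype.card_pos hG
  refine (Reach.assign_seq (L := L) (v := w.length) ?_ (Reach.loop (L := L) (B := 50 * (L + 1))
    (fun j s' => Frame 9 s s' ∧ s'.reg 9 = s.reg 9 ∧ s'.coins = s.coins ∧ s'.arr 3 = s.arr 3 ∧
      s'.reg 10 = w.length - j ∧ HoldsConfig lab (wordAct (w.drop (w.length - j)) x) (s'.arr 2))
    w.length ?_ ?_ ?_)).mono (T' := w.length * (60 * (L + 1)) + 20 * (L + 1)) ?_ ?_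
  · simpa [RExpr.Fits, RExpr.eval, hs.length] using hm
  · refine ⟨(frame_setReg_iff (by omega)).2 (Frame.refl 9 s), by simp, by simp, by simp, by simp, ?_⟩
    simpa [wordAct] using hx
  · rintro s' ⟨-, -, -, -, h, -⟩
    simp [RExpr.Fits, RExpr.eval, h]
  · rintro j hj s' ⟨hf, h9, hc, h3, h10, hx'⟩
    have hi := hs.frame hf (by omega)
    set t := w.length - (j + 1) with ht
    have e1 : w.length - j = t + 1 := by omega
    have htl : t < w.length := by omega
    have hdrop : w.drop t = w[t] :: w.drop (t + 1) := List.drop_eq_getElem_cons htl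
    rw [e1] at h10 hx'
    have i0 := hi.index t htl
    have i1 := hi.sign t htl
    have hwt : wordAct (w.drop t) x = letterAct w[t] (wordAct (w.drop (t + 1)) x) := by
      rw [hdrop]; rfl
    rw [hwt]
    generalize wordAct (w.drop (t + 1)) x = z at hx' ⊢
    generalize w[t] = c at i0 i1 ⊢
    obtain ⟨i, b⟩ := c
    simp only at i0 i1
    have hiu : (i : ℕ) + 1 < n := by have := i.2; omega
    have hl : s'.arr 2 i = lab (z (leftStrand i)).elt := hx' (leftStrand i)
    have hr : s'.arr 2 (i + 1) = lab (z (rightStrand i)).elt := hx' (rightStrand i)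
    have hm' : t + 1 < 2 ^ L := by omega
    have hi0 : (i : ℕ) < 2 ^ L := by omega
    have hi1 : (i : ℕ) + 1 < 2 ^ L := by omega
    have ht0 : t < 2 ^ L := by omega
    have hL : L ≠ 0 := by rintro rfl; simp at h1
    refine ⟨by simp [RExpr.Fits, RExpr.eval, h10, hm'], Reach.mono_time
      (Reach.assign_seq (L := L) (v := t) ?_ <|
        Reach.assign_seq (L := L) (v := i) ?_ <|
        Reach.assign_seq (L := L) (v := lab (z (leftStrand i)).elt) ?_ <|
        Reach.assign_seq (L := L) (v := lab (z (rightStrand i)).elt) (T := 20 * (L + 1)) ?_ ?_)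
      (by simp only [RExpr.nodes]; omega)⟩
    iterate 4 simp [RExpr.Fits, RExpr.eval, h10, i0, hl, hr, hlab, hm', hi0, hi1, ht0, hL]
    cases b
    · refine Reach.mono_time (Reach.ite_neg (L := L) ?_ <|
        Reach.store_seq (L := L) (i := i)
          (v := lab ((z (rightStrand i)).conj (z (leftStrand i)).elt⁻¹).elt) ?_ ?_ <|
        Reach.store (L := L) (i := i + 1) (v := lab (z (leftStrand i)).elt) ?_ ?_
          ⟨?_, ?_, ?_, ?_, ?_, ?config⟩) (by simp only [RExpr.nodes]; omega)
      case config =>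
        rw [letterAct, if_neg (by simp), uncrossFlux_eq_update]
        simp only [RState.arr_setArr, RState.arr_setReg, Function.update_self]
        exact (hx'.update (leftStrand i) _ rfl).update (rightStrand i) _ rfl
      all_goals simp [RExpr.Fits, RExpr.eval, i1, hlab, hi0, hi1, ht0, hL,
        h9, hc, h3, frame_setReg_iff, frame_setArr_iff, hf]
    · refine Reach.mono_time (Reach.ite_pos (L := L) ?_ <|
        Reach.store_seq (L := L) (i := i) (v := lab (z (rightStrand i)).elt) ?_ ?_ <|
        Reach.store (L := L) (i := i + 1)
          (v := lab ((z (leftStrand i)).conj (z (rightStrand i)).elt).elt) ?_ ?_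
          ⟨?_, ?_, ?_, ?_, ?_, ?config⟩) (by simp only [RExpr.nodes]; omega)
      case config =>
        rw [letterAct, if_pos rfl, crossFlux_eq_update]
        simp only [RState.arr_setArr, RState.arr_setReg, Function.update_self]
        exact (hx'.update (leftStrand i) _ rfl).update (rightStrand i) _ rfl
      all_goals simp [RExpr.Fits, RExpr.eval, i1, hlab, hi0, hi1, ht0, h1,
        h9, hc, h3, frame_setReg_iff, frame_setArr_iff, hf]
  · simp only [RExpr.nodes]
    have h : w.length * (50 * (L + 1) + 1 * (L + 1) + 1) ≤ w.length * (60 * (L + 1)) :=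
      Nat.mul_le_mul_left _ (by omega)
    omega
  · rintro s' ⟨hf, h9, hc, h3, -, hx'⟩
    exact ⟨hf, h9, hc, h3, by simpa using hx'⟩

/-- Copy array `2` into array `3`. -/
def copyProg : RProg := forProg 10 2 (.store 3 (.reg 10) (.get 2 (.reg 10)))

theorem reach_copyProg (hG : Fintype.card G < 2 ^ L) (hn : n < 2 ^ L) {s : RState}
    (hs : InputHeld lab g w k s) {x : Fin n → FluxClass g} (hx : HoldsConfig lab x (s.arr 2)) :
    Reach (groupTables lab) copyProg (n * (20 * (L + 1)) + 12 * (L + 1)) s fun s' =>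
      Frame 9 s s' ∧ s'.coins = s.coins ∧ s'.arr 2 = s.arr 2 ∧ HoldsConfig lab x (s'.arr 3) := by
  have hlab := lab_lt (lab := lab) hG
  refine (reach_forProg (L := L) (B := 8 * (L + 1)) (by omega) hn
    (fun j s' => Frame 9 s s' ∧ s'.coins = s.coins ∧ s'.arr 2 = s.arr 2 ∧
      ∀ i : Fin n, (i : ℕ) < j → s'.arr 3 i = lab (x i).elt) ?_ hs.strands ?_ ?_).mono
    (T' := n * (20 * (L + 1)) + 12 * (L + 1)) (by ring_nf; rfl) ?_
  · rintro j s' v ⟨hf, hc, h2, h3⟩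
    exact ⟨(frame_setReg_iff (by omega)).2 hf, hc, h2, h3⟩
  · exact ⟨Frame.refl 9 s, rfl, rfl, by simp⟩
  · rintro j hj s' ⟨hf, hc, h2, h3⟩ hj' hn'
    have hxj : s.arr 2 j = lab (x ⟨j, hj⟩).elt := hx ⟨j, hj⟩
    refine (Reach.store (L := L) (i := j) (v := lab (x ⟨j, hj⟩).elt) ?_ ?_
      ⟨⟨?_, ?_, ?_, ?_⟩, ?_, ?_⟩).mono_time (by simp only [RExpr.nodes]; omega)
    case refine_6 =>
      intro i hi
      simp only [RState.arr_setArr, Function.update_self]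
      rcases Nat.lt_succ_iff_lt_or_eq.1 hi with hi | rfl
      · rw [Function.update_of_ne hi.ne]; exact h3 i hi
      · simp
    all_goals simp [RExpr.Fits, RExpr.eval, hj', h2, hxj, hlab, hj.trans hn, frame_setArr_iff,
      hf, hc, hn']
  · rintro s' ⟨hf, hc, h2, h3⟩
    exact ⟨hf, hc, h2, fun i => h3 i i.2⟩

/-- Replace every flux in an odd position by the inverse of its left neighbour. -/
def mirrorProg : RProg := forProg 10 2 <| .ite (.mod (.reg 10) (.const 2))
  (.store 2 (.reg 10) (.ginv (.get 2 (.sub (.reg 10) (.const 1))))) .skip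

theorem reach_mirrorProg (hG : Fintype.card G < 2 ^ L) (hn : n < 2 ^ L) (hL : 2 < 2 ^ L)
    (h : IsConj g g⁻¹) {s : RState}
    (hs : InputHeld lab g w k s) {x : Fin n → FluxClass g} (hx : HoldsConfig lab x (s.arr 2)) :
    Reach (groupTables lab) mirrorProg (n * (32 * (L + 1)) + 12 * (L + 1)) s fun s' =>
      Frame 9 s s' ∧ s'.coins = s.coins ∧ s'.arr 3 = s.arr 3 ∧
        HoldsConfig lab (mirror h x) (s'.arr 2) := by
  have hlab := lab_lt (lab := lab) hG
  refine (reach_forProg (L := L) (B := 20 * (L + 1)) (by omega) hn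
    (fun j s' => Frame 9 s s' ∧ s'.coins = s.coins ∧ s'.arr 3 = s.arr 3 ∧
      HoldsConfig lab (fun i => if (i : ℕ) < j then mirror h x i else x i) (s'.arr 2))
    ?_ hs.strands ?_ ?_).mono (T' := n * (32 * (L + 1)) + 12 * (L + 1)) (by ring_nf; rfl) ?_
  · rintro j s' v ⟨hf, hc, h3, h2⟩
    exact ⟨(frame_setReg_iff (by omega)).2 hf, hc, h3, h2⟩
  · exact ⟨Frame.refl 9 s, rfl, rfl, by simpa using hx⟩
  · rintro j hj s' ⟨hf, hc, h3, h2⟩ hj' hn'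
    have hjL : j < 2 ^ L := hj.trans hn
    have h1L : 1 < 2 ^ L := by omega
    have hL0 : L ≠ 0 := by rintro rfl; simp at h1L
    rcases Nat.mod_two_eq_zero_or_one j with hp | hp
    · refine (Reach.ite_neg (L := L) (T := 1) ?_ ⟨_, 1, .skip _, le_rfl, ⟨hf, hc, h3, ?_⟩, hj', hn'⟩
        ).mono_time (by simp only [RExpr.nodes]; omega)
      · simp [RExpr.Fits, RExpr.eval, hj', hp, hjL, hL]
      · convert h2 using 2 with i
        rcases lt_trichotomy (i : ℕ) j with hi | hi | hi
        · simp [hi, hi.trans (Nat.lt_succ_self j)]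
        · simp [hi, mirror, hp]
        · simp [hi.not_gt, show ¬ (i : ℕ) < j + 1 by omega]
    -- Working in place is harmless: for odd `j` the cell `j - 1` is even and still holds its
    -- original flux.
    · have hpr : s'.arr 2 (j - 1) = lab (x ⟨j - 1, by omega⟩).elt := by
        have := h2 ⟨j - 1, by omega⟩
        simpa [show j - 1 < j by omega, mirror, show ¬ (j - 1) % 2 = 1 by omega] using this
      refine (Reach.ite_pos (L := L) ?_ <| Reach.store (L := L) (i := j)
        (v := lab ((x ⟨j - 1, by omega⟩).inv h).elt) ?_ ?_
        ⟨⟨?_, ?_, ?_, ?config⟩, ?_, ?_⟩).mono_time (by simp only [RExpr.nodes]; omega)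
      case config =>
        simp only [RState.arr_setArr, Function.update_self]
        convert h2.update ⟨j, hj⟩ _ rfl using 1
        funext i
        rcases lt_trichotomy (i : ℕ) j with hi | hi | hi
        · rw [Function.update_of_ne (by rintro rfl; exact hi.ne rfl)]
          simp [hi, hi.trans (Nat.lt_succ_self j)]
        · obtain rfl : i = ⟨j, hj⟩ := Fin.ext hi
          simp [mirror, hp]
        · rw [Function.update_of_ne (by rintro rfl; exact hi.ne rfl)]
          simp [hi.not_gt, show ¬ (i : ℕ) < j + 1 by omega]
      all_goals simp [RExpr.Fits, RExpr.eval, hj', hp, hpr, hlab, hjL, hL, h1L,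
        frame_setArr_iff, hf, hc, h3, hn', show j - 1 < 2 ^ L by omega]
  · rintro s' ⟨hf, hc, h3, h2⟩
    exact ⟨hf, hc, h3, by simpa using h2⟩

/-- Put into register `9` whether arrays `2` and `3` agree. -/
def testProg : RProg := .seq (.assign 9 (.const 1)) <| forProg 10 2 <|
  .assign 9 (.mul (.reg 9) (.eq (.get 2 (.reg 10)) (.get 3 (.reg 10))))

open Classical in
theorem reach_testProg (hG : Fintype.card G < 2 ^ L) (hn : n < 2 ^ L) {s : RState}
    (hs : InputHeld lab g w k s) {x y : Fin n → FluxClass g} (hx : HoldsConfig lab x (s.arr 2))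
    (hy : HoldsConfig lab y (s.arr 3)) :
    Reach (groupTables lab) testProg (n * (32 * (L + 1)) + 20 * (L + 1)) s fun s' =>
      Frame 9 s s' ∧ s'.coins = s.coins ∧ s'.reg 9 = if x = y then 1 else 0 := by
  have hlab := lab_lt (lab := lab) hG
  have h1L : 1 < 2 ^ L := lt_of_le_of_lt Fintype.card_pos hG
  have hL0 : L ≠ 0 := by rintro rfl; simp at h1L
  refine (Reach.assign_seq (L := L) (v := 1) ?_ <|
    (reach_forProg (L := L) (B := 20 * (L + 1)) (by omega) hn
    (fun j s' => Frame 9 s s' ∧ s'.coins = s.coins ∧ s'.arr 2 = s.arr 2 ∧ s'.arr 3 = s.arr 3 ∧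
      s'.reg 9 = if ∀ i : Fin n, (i : ℕ) < j → x i = y i then 1 else 0)
    ?_ ?_ ?_ ?_)).mono (T' := n * (32 * (L + 1)) + 20 * (L + 1)) ?_ ?_
  · simp [RExpr.Fits, RExpr.eval, hL0]
  · rintro j s' v ⟨hf, hc, h2, h3, h9⟩
    exact ⟨(frame_setReg_iff (by omega)).2 hf, hc, h2, h3, by simpa using h9⟩
  · simpa using hs.strands
  · exact ⟨(frame_setReg_iff (by omega)).2 (Frame.refl 9 s), rfl, rfl, rfl, by simp⟩
  · rintro j hj s' ⟨hf, hc, h2, h3, h9⟩ hj' hn'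
    have hxj : s.arr 2 j = lab (x ⟨j, hj⟩).elt := hx ⟨j, hj⟩
    have hyj : s.arr 3 j = lab (y ⟨j, hj⟩).elt := hy ⟨j, hj⟩
    have hiff : (∀ i : Fin n, (i : ℕ) < j + 1 → x i = y i) ↔
        (∀ i : Fin n, (i : ℕ) < j → x i = y i) ∧ x ⟨j, hj⟩ = y ⟨j, hj⟩ := by
      refine ⟨fun h => ⟨fun i hi => h i (by omega), h ⟨j, hj⟩ (Nat.lt_succ_self j)⟩, ?_⟩
      rintro ⟨h, h'⟩ i hi
      rcases Nat.lt_succ_iff_lt_or_eq.1 hi with hi | rfl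
      exacts [h i hi, h']
    have hel : (lab (x ⟨j, hj⟩).elt : ℕ) = lab (y ⟨j, hj⟩).elt ↔ x ⟨j, hj⟩ = y ⟨j, hj⟩ := by
      rw [Fin.val_inj, lab.injective.eq_iff]
      exact ⟨FluxClass.ext_elt, congrArg _⟩
    refine (Reach.assign (L := L)
      (v := if ∀ i : Fin n, (i : ℕ) < j + 1 → x i = y i then 1 else 0) ⟨?_, ?_⟩
      ⟨⟨?_, ?_, ?_, ?_, ?_⟩, ?_, ?_⟩).mono_time (by simp only [RExpr.nodes]; omega)
    case refine_1 =>
      simp only [RExpr.Fits, RExpr.eval, hj', h2, h3, h9, hxj, hyj, hlab, hj.trans hn, true_and]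
      refine ⟨?_, ?_, ?_⟩ <;> split_ifs <;> simp [hL0]
    case refine_2 =>
      simp only [RExpr.eval, hj', h2, h3, h9, hxj, hyj, hel, hiff]
      split_ifs <;> simp_all
    all_goals simp [frame_setReg_iff, hf, hc, h2, h3, hj', hn']
  · simp only [RExpr.nodes]
    ring_nf
    omega
  · rintro s' ⟨hf, hc, -, -, h9⟩
    exact ⟨hf, hc, by simpa [funext_iff] using h9⟩

end Programs

/-! ### The sampling program and the trial loop -/

section SampleProgram

variable {G : Type u} [Group G] [Fintype G] {lab : G ≃ Fin (Fintype.card G)} {g : G} {n : ℕ}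
  {w : BraidWord n} {k L : ℕ}

theorem bitsVal_take_succ (u : ℕ) (l : List Bool) {j : ℕ} (hj : j < l.length) :
    bitsVal u (l.take (j + 1)) = 2 * bitsVal u (l.take j) + l[j].toNat := by
  rw [List.take_succ_eq_append_getElem hj, bitsVal, List.foldl_append]
  rfl

/-- Put a random number into register `11`, using as many coin tosses as are needed for at least
as many values as the content of register `7`. -/
def bitsProg : RProg :=
  .seq (.assign 11 (.const 0)) <| .seq (.assign 12 (.const 1)) <|
  .loop (.lt (.reg 12) (.reg 7)) <| .seq (.coin 13) <|
  .seq (.assign 11 (.add (.mul (.const 2) (.reg 11)) (.reg 13)))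
    (.assign 12 (.mul (.const 2) (.reg 12)))

/-- Register `12` doubles until it reaches `Q`, so every run uses exactly `Nat.clog 2 Q` tosses.
This fixed number is what splits the coins into blocks of equal length. -/
theorem reach_bitsProg {tab : GroupTables} {Q : ℕ} (hQ : 2 * Q < 2 ^ L) (h1L : 1 < 2 ^ L)
    {s : RState} (hs : s.reg 7 = Q) {l rest : List Bool} (hl : l.length = Nat.clog 2 Q)
    (hc : s.coins = l ++ rest) :
    Reach tab bitsProg (L * (20 * (L + 1)) + 12 * (L + 1)) s fun s' =>
      Frame 11 s s' ∧ s'.arr = s.arr ∧ s'.coins = rest ∧ s'.reg 11 = bitsVal 0 l ∧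
        bitsVal 0 l < 2 ^ L := by
  have hL0 : L ≠ 0 := by rintro rfl; simp at h1L
  have hQL : Q < 2 ^ L := by omega
  -- The last power of two before `Q` is reached is below `Q`, so the final one is below `2 * Q`;
  -- for `Q ≤ 1` there are no tosses.
  have hpow : 2 ^ Nat.clog 2 Q < 2 ^ L := by
    rcases Nat.lt_or_ge 1 Q with h | h
    · have h1 := Nat.pow_pred_clog_lt_self (b := 2) (by norm_num) h
      have h2 : 0 < Nat.clog 2 Q := Nat.clog_pos (by norm_num) h
      obtain ⟨c, hc⟩ := Nat.exists_eq_succ_of_ne_zero h2.ne'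
      rw [hc, Nat.pred_succ] at h1
      rw [hc, pow_succ]
      omega
    · rw [Nat.clog_of_right_le_one h]; simpa using h1L
  have hKL : Nat.clog 2 Q ≤ L := ((Nat.pow_lt_pow_iff_right (by norm_num)).1 hpow).le
  refine (Reach.assign_seq (L := L) (v := 0) ?_ <| Reach.assign_seq (L := L) (v := 1) ?_ <|
    Reach.loop (L := L) (B := 16 * (L + 1)) (fun j s' => Frame 11 s s' ∧ s'.arr = s.arr ∧
      s'.coins = l.drop j ++ rest ∧ s'.reg 11 = bitsVal 0 (l.take j) ∧ s'.reg 12 = 2 ^ j)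
      (Nat.clog 2 Q) ?_ ?_ ?_).mono (T' := L * (20 * (L + 1)) + 12 * (L + 1)) ?_ ?_
  · simp [RExpr.Fits, RExpr.eval]
  · simp [RExpr.Fits, RExpr.eval, hL0]
  · exact ⟨by simp [frame_setReg_iff, Frame.refl], rfl, by simpa using hc, by simp [bitsVal],
      by simp⟩
  · rintro s' ⟨hf, -, -, -, h12⟩
    have h7 : s'.reg 7 = Q := (hf.reg 7 (by omega)).trans hs
    have := Nat.le_pow_clog (b := 2) (by norm_num) Q
    simp [RExpr.Fits, RExpr.eval, h12, h7, hQL, hpow, this]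
    split_ifs <;> omega
  · rintro j hj s' ⟨hf, ha, hc', h11, h12⟩
    have h7 : s'.reg 7 = Q := (hf.reg 7 (by omega)).trans hs
    have hjl : j < l.length := hl ▸ hj
    have hjQ : 2 ^ j < Q := (Nat.lt_clog_iff_pow_lt (by norm_num)).1 hj
    have hu : bitsVal 0 (l.take j) < 2 ^ j := by
      simpa [hjl.le] using bitsVal_lt (l.take j) 0
    have hb := Bool.toNat_le l[j]
    have hpos : 0 < 2 ^ j := Nat.two_pow_pos j
    refine ⟨by simp [RExpr.Fits, RExpr.eval, h12, h7, hQL, hjQ, hjQ.trans hQL, hL0],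
      Reach.mono_time (Reach.seq (Reach.coin (b := l[j]) (l := l.drop (j + 1) ++ rest) ?_ <|
      Reach.assign_seq (L := L) (v := 2 * bitsVal 0 (l.take j) + l[j].toNat) ⟨?_, ?_⟩ <|
      Reach.assign (L := L) (v := 2 * 2 ^ j) ⟨?_, ?_⟩ ⟨?_, ?_, ?_, ?_, ?_⟩))
      (by simp only [RExpr.nodes]; omega)⟩
    · rw [hc', List.drop_eq_getElem_cons hjl]; rfl
    · simp only [RExpr.Fits, RExpr.eval]
      simp [h11]
      omega
    · simp [RExpr.eval, h11]
    · simp only [RExpr.Fits, RExpr.eval]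
      simp [h12]
      omega
    · simp [RExpr.eval, h12]
    · simp [frame_setReg_iff, frame_setCoins_iff, hf]
    · simp [ha]
    · simp
    · simp [bitsVal_take_succ 0 l hjl]
    · simp [pow_succ']
  · simp only [RExpr.nodes]
    have h : Nat.clog 2 Q * (16 * (L + 1) + (1 + 1 + 1) * (L + 1) + 1) ≤ L * (20 * (L + 1)) :=
      Nat.mul_le_mul hKL (by omega)
    omega
  · rintro s' ⟨hf, ha, hc', h11, -⟩
    refine ⟨hf, ha, by simpa [← hl] using hc', by simpa [← hl] using h11, ?_⟩
    refine lt_of_lt_of_le (bitsVal_lt l 0) ?_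
    rw [hl]
    omega

/-- Put a random flux configuration into array `2`. -/
def sampleProg : RProg := forProg 10 2 <| .seq bitsProg <|
  .seq (.assign 14 (.mod (.reg 11) (.reg 0)))
    (.store 2 (.reg 10) (.gmul (.gmul (.reg 14) (.reg 1)) (.ginv (.reg 14))))

theorem lab_drawElt (l : List Bool) :
    (lab (drawElt lab l) : ℕ) = bitsVal 0 l % Fintype.card G := by
  simp [drawElt]

theorem reach_sampleProg {Q : ℕ} (hQ : 2 * Q < 2 ^ L) (hG : Fintype.card G < 2 ^ L)
    (hn : n < 2 ^ L) {s : RState} (hs : InputHeld lab g w k s) (h7 : s.reg 7 = Q)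
    {l rest : List Bool} (hl : l.length = n * Nat.clog 2 Q) (hc : s.coins = l ++ rest) :
    Reach (groupTables lab) sampleProg (n * (L * (20 * (L + 1)) + 50 * (L + 1)) + 12 * (L + 1)) s
      fun s' => Frame 9 s s' ∧ s'.coins = rest ∧
        HoldsConfig lab (drawConfig lab g (Nat.clog 2 Q) n l) (s'.arr 2) := by
  have hlab := lab_lt (lab := lab) hG
  have h1L : 1 < 2 ^ L := lt_of_le_of_lt Fintype.card_pos hG
  set K := Nat.clog 2 Q with hK
  refine (reach_forProg (L := L) (B := L * (20 * (L + 1)) + 38 * (L + 1)) (by omega) hn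
    (fun j s' => Frame 9 s s' ∧ s'.coins = l.drop (j * K) ++ rest ∧
      ∀ i : Fin n, (i : ℕ) < j → s'.arr 2 i = lab (drawConfig lab g K n l i).elt)
    ?_ hs.strands ?_ ?_).mono
    (T' := n * (L * (20 * (L + 1)) + 50 * (L + 1)) + 12 * (L + 1)) (by ring_nf; rfl) ?_
  · rintro j s' v ⟨hf, hc, h2⟩
    exact ⟨(frame_setReg_iff (by omega)).2 hf, hc, h2⟩
  · exact ⟨Frame.refl 9 s, by simpa using hc, by simp⟩
  · rintro j hj s' ⟨hf, hc, h2⟩ hj' hn'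
    have hjK : (j + 1) * K ≤ n * K := Nat.mul_le_mul_right _ hj
    rw [Nat.succ_mul] at hjK
    refine Reach.mono_time (Reach.seq ((reach_bitsProg (l := (l.drop (j * K)).take K)
      (rest := l.drop ((j + 1) * K) ++ rest) hQ h1L ((hf.reg 7 (by omega)).trans h7) ?_ ?_).mono
      le_rfl ?_)) (T := L * (20 * (L + 1)) + 12 * (L + 1) + 20 * (L + 1) + 1) (by omega)
    · rw [List.length_take, List.length_drop, ← hK]; omega
    · rw [hc, Nat.succ_mul, ← List.drop_drop, ← List.append_assoc, List.take_append_drop]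
    · rintro s'' ⟨hf', ha', hc', h11, hlt⟩
      -- `bitsProg` preserves all registers below `11`, in particular the strand counter.
      have h10 : s''.reg 10 = j := (hf'.reg 10 (by omega)).trans hj'
      have hf9 : Frame 9 s s'' := hf.trans hf' (by omega)
      have h0 : s''.reg 0 = Fintype.card G := (hf9.reg 0 (by omega)).trans hs.card
      have h1 : s''.reg 1 = lab g := (hf9.reg 1 (by omega)).trans hs.elt
      have hn'' : s''.reg 2 = n := (hf'.reg 2 (by omega)).trans hn'
      set e := drawElt lab ((l.drop (j * K)).take K) with he
      have hmod := lab_drawElt (lab := lab) ((l.drop (j * K)).take K)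
      rw [← he] at hmod
      refine Reach.mono_time (Reach.assign_seq (L := L) (v := lab e) ?_ <|
        Reach.store (L := L) (i := j) (v := lab (e * g * e⁻¹)) ?_ ?_ ⟨⟨?_, ?_, ?_⟩, ?_, ?_⟩)
        (by simp only [RExpr.nodes]; omega)
      case refine_6 =>
        intro i hi
        simp only [RState.arr_setArr, RState.arr_setReg, Function.update_self, ha']
        rcases Nat.lt_succ_iff_lt_or_eq.1 hi with hi | rfl
        · rw [Function.update_of_ne hi.ne]; exact h2 i hi
        · rw [Function.update_self]; rfl
      all_goals simp [RExpr.Fits, RExpr.eval, h10, h0, h1, h11, ← hmod, hlab, hj.trans hn, hlt, hG,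
        frame_setReg_iff, frame_setArr_iff, hf9, hc', hn'']
  · rintro s' ⟨hf, hc, h2⟩
    refine ⟨hf, ?_, fun i => h2 i i.2⟩
    rwa [← hl, List.drop_length, List.nil_append] at hc

/-- Output the fraction of random configurations that are accepted by the program `C`. -/
def approxProg (C : RProg) : RProg :=
  .seq (.assign 7 (.mul (.mul (.const 2) (.reg 4)) (.mul (.reg 2) (.reg 0)))) <|
  .seq (.assign 8 (.mul (.const 5) (.mul (.reg 4) (.reg 4)))) <|
  .seq (.assign 6 (.const 0)) <|
  .seq (forProg 5 8 (.seq sampleProg (.seq C (.assign 6 (.add (.reg 6) (.reg 9)))))) <|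
  .seq (.assign 0 (.reg 6)) (.assign 1 (.reg 8))

open Classical in
/-- The program `C` decides within `B` units of time whether the configuration in array `2` has
the property `A`. -/
def Decides (lab : G ≃ Fin (Fintype.card G)) (g : G) (w : BraidWord n) (k : ℕ) (C : RProg) (B : ℕ)
    (A : (Fin n → FluxClass g) → Prop) : Prop :=
  ∀ (s : RState) (x : Fin n → FluxClass g), InputHeld lab g w k s → HoldsConfig lab x (s.arr 2) →
    Reach (groupTables lab) C B s fun s' =>
      Frame 9 s s' ∧ s'.coins = s.coins ∧ s'.reg 9 = if A x then 1 else 0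

open Classical in
-- Trial number, count of accepted samples, sampling range and number of trials sit in registers `5`
-- to `8`, which the sampler and the test `C` preserve. The input registers `0` and `1` are
-- overwritten only at the end, by the output fraction.
theorem reach_approxProg {C : RProg} {B : ℕ} {A : (Fin n → FluxClass g) → Prop}
    (hC : Decides lab g w k C B A) (hQ : 2 * (2 * k * (n * Fintype.card G)) < 2 ^ L)
    (hk : 5 * (k * k) < 2 ^ L) (hk0 : 0 < k) (hG : Fintype.card G < 2 ^ L) (hn : n < 2 ^ L)
    {s : RState} (hs : InputHeld lab g w k s) {l rest : List Bool}
    (hl : l.length = 5 * (k * k) * (n * Nat.clog 2 (2 * k * (n * Fintype.card G))))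
    (hc : s.coins = l ++ rest) :
    Reach (groupTables lab) (approxProg C)
      (5 * (k * k) * (n * (L * (20 * (L + 1)) + 50 * (L + 1)) + B + 40 * (L + 1)) + 60 * (L + 1)) s
      fun s' => (s'.output : ℝ) =
        blockSum (n * Nat.clog 2 (2 * k * (n * Fintype.card G))) (fun l' =>
          if A (drawConfig lab g (Nat.clog 2 (2 * k * (n * Fintype.card G))) n l') then 1 else 0)
          (5 * (k * k)) l / (5 * (k * k) : ℕ) := by
  have h5 : 5 < 2 ^ L := by nlinarith
  have hL0 : L ≠ 0 := by rintro rfl; simp at h5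
  have hkL : k < 2 ^ L := by nlinarith
  have hkkL : k * k < 2 ^ L := by omega
  have hGpos : 0 < Fintype.card G := Fintype.card_pos
  set Q := 2 * k * (n * Fintype.card G) with hQdef
  set K := Nat.clog 2 Q with hK
  set N := 5 * (k * k) with hN
  -- The number of accepted samples after `i` trials, as a natural number; `cnt i ≤ i` keeps it
  -- within `L` bits.
  set cnt : ℕ → ℕ := fun i => ∑ t ∈ Finset.range i,
    if A (drawConfig lab g K n ((l.drop (t * (n * K))).take (n * K))) then 1 else 0 with hcnt
  have hcnt_le : ∀ i, cnt i ≤ i := fun i => by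
    refine (Finset.sum_le_card_nsmul _ _ 1 fun t _ => ?_).trans (by simp)
    split_ifs <;> omega
  have hnG : n * Fintype.card G < 2 ^ L := by nlinarith
  have hQL : Q < 2 ^ L := by omega
  have h2k : 2 * k < 2 ^ L := by nlinarith
  have h2L : 2 < 2 ^ L := by omega
  refine (Reach.assign_seq (L := L) (v := Q) ?_ <| Reach.assign_seq (L := L) (v := N) ?_ <|
    Reach.assign_seq (L := L) (v := 0) ?_ <| Reach.seq (T' := 4 * (L + 1)) <|
    (reach_forProg (L := L)
      (B := n * (L * (20 * (L + 1)) + 50 * (L + 1)) + B + 28 * (L + 1)) (by omega) hk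
    (fun i s' => Frame 5 s s' ∧ s'.reg 6 = cnt i ∧ s'.reg 7 = Q ∧ s'.reg 8 = N ∧
      s'.coins = l.drop (i * (n * K)) ++ rest)
    ?_ ?_ ?_ ?_).mono le_rfl ?_).mono_time
    (T' := N * (n * (L * (20 * (L + 1)) + 50 * (L + 1)) + B + 40 * (L + 1)) + 60 * (L + 1)) ?_
  · simp [RExpr.Fits, RExpr.eval, hs.accuracy, hs.strands, hs.card, h2L, hkL, h2k, hn, hG, hnG,
      hQL, ← hQdef]
  · simp [RExpr.Fits, RExpr.eval, hs.accuracy, h5, hkL, hkkL, hk, ← hN]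
  · simp [RExpr.Fits, RExpr.eval]
  · rintro i s' v ⟨hf, h6, h7, h8, hc⟩
    exact ⟨(frame_setReg_iff (by omega)).2 hf, by simpa using h6, by simpa using h7,
      by simpa using h8, hc⟩
  · simp
  · exact ⟨by simp [frame_setReg_iff, Frame.refl], by simp [hcnt], by simp, by simp,
      by simpa using hc⟩
  · rintro i hi s' ⟨hf, h6, h7, h8, hc⟩ hi' _
    have hiK : (i + 1) * (n * K) ≤ N * (n * K) := Nat.mul_le_mul_right _ hi
    rw [Nat.succ_mul] at hiK
    have hs' := hs.frame hf le_rfl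
    refine Reach.mono_time (Reach.seq ((reach_sampleProg
      (l := (l.drop (i * (n * K))).take (n * K)) (rest := l.drop ((i + 1) * (n * K)) ++ rest)
      hQ hG hn hs' h7 ?_ ?_).mono le_rfl ?_))
      (T := (n * (L * (20 * (L + 1)) + 50 * (L + 1)) + 12 * (L + 1)) + (B + 4 * (L + 1) + 1) + 1)
      (by omega)
    · rw [List.length_take, List.length_drop, ← hK]; omega
    · rw [hc, Nat.succ_mul, ← List.drop_drop, ← List.append_assoc, List.take_append_drop]
    · rintro s₁ ⟨hf₁, hc₁, hx⟩
      refine Reach.mono_time (Reach.seq ((hC s₁ _ (hs'.frame hf₁ (by omega)) hx).mono le_rfl ?_))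
        (T := B + (3 * (L + 1) + 1) + 1) (by omega)
      rintro s₂ ⟨hf₂, hc₂, h9⟩
      have hf' : Frame 9 s' s₂ := hf₁.trans hf₂ le_rfl
      have e6 : s₂.reg 6 = cnt i := (hf'.reg 6 (by omega)).trans h6
      have e : cnt (i + 1) = cnt i + s₂.reg 9 := by
        rw [h9, hcnt]; exact Finset.sum_range_succ _ _
      have hb : cnt (i + 1) < 2 ^ L := (hcnt_le _).trans_lt (by omega)
      refine Reach.assign (L := L) (v := cnt (i + 1)) ⟨?_, ?_⟩ ⟨⟨?_, ?_, ?_, ?_, ?_⟩, ?_, ?_⟩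
      · simp only [RExpr.Fits, RExpr.eval, e6]; omega
      · simp only [RExpr.eval, e6, e]
      · exact (frame_setReg_iff (by omega)).2 (hf.trans hf' (by omega))
      · simp
      · simpa using (hf'.reg 7 (by omega)).trans h7
      · simpa using (hf'.reg 8 (by omega)).trans h8
      · simp [hc₂, hc₁]
      · simpa using (hf'.reg 5 (by omega)).trans hi'
      · simpa using (hf'.reg 8 (by omega)).trans h8
  · rintro s' ⟨hf, h6, h7, h8, -⟩
    have hb : cnt N < 2 ^ L := (hcnt_le _).trans_lt hk
    refine Reach.mono_time (Reach.assign_seq (L := L) (v := cnt N) ?_ <|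
      Reach.assign (L := L) (v := N) ?_ ?_) (by simp only [RExpr.nodes]; omega)
    · simp [RExpr.Fits, RExpr.eval, h6, hb]
    · simp [RExpr.Fits, RExpr.eval, h8, hk]
    · simp [RState.output, blockSum, hcnt]
  · simp only [RExpr.nodes]
    ring_nf
    omega

end SampleProgram

/-! ### The two tests and the error analysis -/

section Approximation

variable {G : Type u} [Group G] [Fintype G] {lab : G ≃ Fin (Fintype.card G)} {g : G} {n : ℕ}
  {w : BraidWord n} {k L : ℕ}

/-- Decide whether a configuration is fixed by the braid. -/
def fixedProg : RProg := .seq copyProg <| .seq braidProg testProg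

/-- The copy comes first because `braidProg` overwrites array `2` and leaves array `3` alone. -/
theorem decides_fixedProg (hG : Fintype.card G < 2 ^ L) (hn : n < 2 ^ L) (hm : w.length < 2 ^ L) :
    Decides lab g w k fixedProg
      (n * (20 * (L + 1)) + 12 * (L + 1) + (w.length * (60 * (L + 1)) + 20 * (L + 1) +
        (n * (32 * (L + 1)) + 20 * (L + 1)) + 1) + 1) fun x => wordAct w x = x := by
  intro s x hs hx
  refine Reach.seq ((reach_copyProg hG hn hs hx).mono le_rfl ?_)
  rintro s₁ ⟨hf₁, hc₁, h2, h3⟩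
  have hs₁ := hs.frame hf₁ (by omega)
  refine Reach.seq ((reach_braidProg hG hn hm hs₁ (h2 ▸ hx)).mono le_rfl ?_)
  rintro s₂ ⟨hf₂, -, hc₂, h3', h2'⟩
  refine (reach_testProg hG hn (hs₁.frame hf₂ (by omega)) h2' (h3' ▸ h3)).mono le_rfl ?_
  rintro s₃ ⟨hf₃, hc₃, h9⟩
  exact ⟨(hf₁.trans hf₂ le_rfl).trans hf₃ le_rfl, hc₃.trans (hc₂.trans hc₁), by convert h9⟩

/-- Decide whether the braid maps the plat configuration next to a configuration to a plat
configuration. -/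
def platProg : RProg :=
  .seq mirrorProg <| .seq braidProg <| .seq copyProg <| .seq mirrorProg testProg

/-- The image under the braid is a plat configuration exactly if mirroring does not change it, so it
is copied, mirrored and compared with the copy. -/
theorem decides_platProg (hG : Fintype.card G < 2 ^ L) (hn : n < 2 ^ L) (hm : w.length < 2 ^ L)
    (hL : 2 < 2 ^ L) (h : IsConj g g⁻¹) :
    Decides lab g w k platProg
      (n * (32 * (L + 1)) + 12 * (L + 1) + (w.length * (60 * (L + 1)) + 20 * (L + 1) +
        (n * (20 * (L + 1)) + 12 * (L + 1) + (n * (32 * (L + 1)) + 12 * (L + 1) +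
        (n * (32 * (L + 1)) + 20 * (L + 1)) + 1) + 1) + 1) + 1)
      fun x => mirror h (wordAct w (mirror h x)) = wordAct w (mirror h x) := by
  intro s x hs hx
  refine Reach.seq ((reach_mirrorProg hG hn hL h hs hx).mono le_rfl ?_)
  rintro s₁ ⟨hf₁, hc₁, -, h2⟩
  have hs₁ := hs.frame hf₁ (by omega)
  refine Reach.seq ((reach_braidProg hG hn hm hs₁ h2).mono le_rfl ?_)
  rintro s₂ ⟨hf₂, -, hc₂, -, h2'⟩
  have hs₂ := hs₁.frame hf₂ (by omega)
  refine Reach.seq ((reach_copyProg hG hn hs₂ h2').mono le_rfl ?_)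
  rintro s₃ ⟨hf₃, hc₃, e2, h3⟩
  have hs₃ := hs₂.frame hf₃ (by omega)
  refine Reach.seq ((reach_mirrorProg hG hn hL h hs₃ (e2 ▸ h2')).mono le_rfl ?_)
  rintro s₄ ⟨hf₄, hc₄, e3, h2''⟩
  refine (reach_testProg hG hn (hs₃.frame hf₄ (by omega)) h2'' (e3 ▸ h3)).mono le_rfl ?_
  rintro s₅ ⟨hf₅, hc₅, h9⟩
  exact ⟨(((hf₁.trans hf₂ le_rfl).trans hf₃ le_rfl).trans hf₄ le_rfl).trans hf₅ le_rfl,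
    hc₅.trans (hc₄.trans (hc₃.trans (hc₂.trans hc₁))), by convert h9⟩

set_option linter.unusedSectionVars false in
theorem inputHeld_braidInput (coins : List Bool) :
    InputHeld lab g w k (braidInput lab g w k coins) where
  card := rfl
  elt := rfl
  strands := rfl
  length := rfl
  accuracy := rfl
  index j hj := by simp [braidInput, hj]
  sign j hj := by simp [braidInput, hj]

open Classical in
-- The tolerance `1 / k` is divided equally between the bias of the sampler and the statistical
-- fluctuation.
theorem approximatesWithin_approxProg {C : RProg} {B T : ℕ} {A : (Fin n → FluxClass g) → Prop}
    (hC : Decides lab g w k C B A) (hQ : 2 * (2 * k * (n * Fintype.card G)) < 2 ^ L)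
    (hk : 5 * (k * k) < 2 ^ L) (hk0 : 0 < k) (hG : Fintype.card G < 2 ^ L) (hn : n < 2 ^ L)
    (hT : 5 * (k * k) * (n * (L * (20 * (L + 1)) + 50 * (L + 1)) + B + 40 * (L + 1)) +
      60 * (L + 1) ≤ T) {good : ℚ → Prop}
    (hgood : ∀ q : ℚ, |(q : ℝ) - fluxMean g n fun x => if A x then 1 else 0| ≤ 1 / k → good q) :
    ApproximatesWithin (groupTables lab) (approxProg C) (braidInput lab g w k) T good := by
  have hkR : (0 : ℝ) < k := Nat.cast_pos.2 hk0
  have hreach := fun (l rest : List Bool) hl => reach_approxProg (l := l) (rest := rest)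
    (s := braidInput lab g w k (l ++ rest)) hC hQ hk hk0 hG hn (inputHeld_braidInput _) hl rfl
  set Q := 2 * k * (n * Fintype.card G) with hQdef
  set K := Nat.clog 2 Q with hK
  set N := 5 * (k * k) with hN
  set f : List Bool → ℝ := fun l => if A (drawConfig lab g K n l) then 1 else 0 with hf
  have hKL : K ≤ L := Nat.clog_le_of_le_pow (by omega)
  -- A toss without coins has no run, so the `T` supplied tosses must cover all trials.
  have hNT : N * (n * K) ≤ T := by
    refine le_trans ?_ hT
    have h1 : K ≤ L * (20 * (L + 1)) + 50 * (L + 1) := by nlinarith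
    have h2 : n * K ≤ n * (L * (20 * (L + 1)) + 50 * (L + 1)) + B + 40 * (L + 1) := by
      have := Nat.mul_le_mul_left n h1; omega
    have := Nat.mul_le_mul_left N h2
    omega
  have hrun : ∀ l : List Bool, l.length = T → ∃ s t,
      Exec (groupTables lab) (approxProg C) (braidInput lab g w k l) s t ∧ t ≤ T ∧
        (s.output : ℝ) = blockSum (n * K) f N l / N := by
    intro l hl
    have hlen : (l.take (N * (n * K))).length = N * (n * K) := by
      rw [List.length_take]; omega
    obtain ⟨s, t, h1, h2, h3⟩ := hreach (l.take (N * (n * K))) (l.drop (N * (n * K))) hlen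
    rw [← blockSum_append f (l.drop (N * (n * K))) hlen] at h3
    rw [List.take_append_drop] at h1 h3
    exact ⟨s, t, h1, h2.trans hT, h3⟩
  have hbias : |coinMean (n * K) f - fluxMean g n fun x => if A x then 1 else 0| ≤ 1 / (2 * k) := by
    refine (abs_coinMean_drawConfig_sub_le lab g K n (f := fun x => if A x then 1 else 0)
      (fun x => by split_ifs <;> norm_num) fun x => by split_ifs <;> norm_num).trans ?_
    have h1 : (2 * k * (n * Fintype.card G) : ℝ) ≤ 2 ^ K := by
      exact_mod_cast Nat.le_pow_clog (b := 2) (by norm_num) Q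
    rw [mul_div_assoc', div_le_div_iff₀ (by positivity) (by positivity)]
    linarith
  refine ⟨fun r => ?_, ?_⟩
  · obtain ⟨s, t, h1, h2, -⟩ := hrun (List.ofFn r) (by simp)
    exact ⟨s, t, h1, h2⟩
  · rw [natCard_ofFn_div T fun l => ∃ s t,
      Exec (groupTables lab) (approxProg C) (braidInput lab g w k l) s t ∧ ¬ good s.output]
    have htail := coinMean_blockSum_tail (M := n * K) (f := f) (N := N) (T := T)
      (fun l => by simp only [hf]; split_ifs <;> norm_num)
      (fun l => by simp only [hf]; split_ifs <;> norm_num) hNT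
      (δ := 1 / (2 * k)) (by positivity) (by positivity)
    refine lt_of_le_of_lt ((coinMean_mono fun l hl => ?_).trans htail) ?_
    · split_ifs with h1 h2
      · exact le_rfl
      · exfalso
        obtain ⟨s, t, hs, hbad⟩ := h1
        obtain ⟨s', t', hs', -, hout⟩ := hrun l hl
        obtain rfl := hs.unique hs'
        refine hbad (hgood _ ?_)
        rw [hout]
        refine (abs_sub_le _ (coinMean (n * K) f) _).trans
          ((add_le_add (not_lt.1 h2) hbias).trans (le_of_eq ?_))
        field_simp
        norm_num
      · norm_num
      · norm_num
    · rw [hN]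
      push_cast
      -- This explains the number `5 k²` of trials: `4 k²` would give `1 / 4`, and the inequality
      -- has to be strict.
      have : (1 : ℝ) / (4 * (5 * (k * k)) * (1 / (2 * k)) ^ 2) = 1 / 5 := by
        field_simp
        norm_num
      rw [this]
      norm_num

end Approximation

/-! ### Bit length and polynomial time bounds -/

section Bounds

/-- A bound for the number of bits of the numbers that occur in a computation. -/
def bitBound {R : Type*} [CommSemiring R] (m n c k : R) : R := c + n + m + 2 * k + 4

/-- From `a < 2 ^ a`, exponents add up over products. This is crude in `m`, `n` and `k`, but those
may enter the running time polynomially; only `N`, the group order, needs its logarithm. -/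
theorem lt_two_pow_bitBound (m n N k : ℕ) :
    N < 2 ^ bitBound m n (Nat.log 2 N) k ∧ n < 2 ^ bitBound m n (Nat.log 2 N) k ∧
    m < 2 ^ bitBound m n (Nat.log 2 N) k ∧ 5 * (k * k) < 2 ^ bitBound m n (Nat.log 2 N) k ∧
    2 * (2 * k * (n * N)) < 2 ^ bitBound m n (Nat.log 2 N) k ∧
    2 < 2 ^ bitBound m n (Nat.log 2 N) k := by
  have hN' : N < 2 ^ (Nat.log 2 N + 1) := Nat.lt_pow_succ_log_self (by norm_num) N
  have hn : n < 2 ^ n := Nat.lt_two_pow_self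
  have hm : m < 2 ^ m := Nat.lt_two_pow_self
  have hk : k < 2 ^ k := Nat.lt_two_pow_self
  have hle : ∀ {a e : ℕ}, a < 2 ^ e → e ≤ bitBound m n (Nat.log 2 N) k →
      a < 2 ^ bitBound m n (Nat.log 2 N) k := fun ha he =>
    ha.trans_le (Nat.pow_le_pow_right (by norm_num) he)
  simp only [bitBound] at *
  refine ⟨hle hN' (by omega), hle hn (by omega), hle hm (by omega),
    hle (e := k + k + 3) ?_ (by omega), hle (e := k + (n + (Nat.log 2 N + 1)) + 2) ?_ (by omega),
    hle (e := 2) (by norm_num) (by omega)⟩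
  · have hkk : k * k < 2 ^ k * 2 ^ k := Nat.mul_lt_mul'' hk hk
    rw [pow_add, pow_add]
    omega
  · have h1 : n * N < 2 ^ n * 2 ^ (Nat.log 2 N + 1) := Nat.mul_lt_mul'' hn hN'
    have h2 : k * (n * N) < 2 ^ k * (2 ^ n * 2 ^ (Nat.log 2 N + 1)) := Nat.mul_lt_mul'' hk h1
    rw [pow_add, pow_add, pow_add 2 n]
    linarith

/-- A bound for the running time of the computation of a matrix entry. -/
def entryTime {R : Type*} [CommSemiring R] (L m n : R) : R :=
  (m * (60 * (L + 1)) + 20 * (L + 1)) + ((n * (32 * (L + 1)) + 20 * (L + 1)) + 5 * (L + 1) + 1) + 1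

/-- A bound for the running time of one test of a random configuration. -/
def trialTime {R : Type*} [CommSemiring R] (L m n : R) : R :=
  n * (32 * (L + 1)) + 12 * (L + 1) + (m * (60 * (L + 1)) + 20 * (L + 1) +
    (n * (20 * (L + 1)) + 12 * (L + 1) + (n * (32 * (L + 1)) + 12 * (L + 1) +
    (n * (32 * (L + 1)) + 20 * (L + 1)) + 1) + 1) + 1) + 1

/-- A bound for the running time of the approximation of a link invariant. -/
def approxTime {R : Type*} [CommSemiring R] (L m n k : R) : R :=
  5 * (k * k) * (n * (L * (20 * (L + 1)) + 50 * (L + 1)) + trialTime L m n + 40 * (L + 1)) +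
    60 * (L + 1)

/-- The bounds are written over an arbitrary commutative semiring, so that one formula is both the
polynomial and its value. -/
theorem eval_approxTime (m n c k : ℕ) :
    MvPolynomial.eval ![m, n, c, k]
      (approxTime (bitBound (.X 0) (.X 1) (.X 2) (.X 3)) (.X 0) (.X 1) (.X 3)) =
      approxTime (bitBound m n c k) m n k := by
  simp [approxTime, trialTime, bitBound]

end Bounds

/-! ### Matrix entries, passage to `ε`, and the theorem -/

section Main

variable {G : Type u} [Group G] [Fintype G] {lab : G ≃ Fin (Fintype.card G)} {g : G} {n : ℕ}
  {w : BraidWord n} {k L : ℕ}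

/-- Compute a matrix entry. -/
def entryProg : RProg :=
  .seq braidProg <| .seq testProg <| .seq (.assign 0 (.reg 9)) (.assign 1 (.const 1))

theorem inputHeld_entryInput (x y : Fin n → FluxClass g) (coins : List Bool) :
    InputHeld lab g w 0 (entryInput lab w x y coins) where
  card := rfl
  elt := rfl
  strands := rfl
  length := rfl
  accuracy := rfl
  index j hj := by simp [entryInput, braidInput, hj]
  sign j hj := by simp [entryInput, braidInput, hj]

theorem holdsConfig_fluxLabels (x : Fin n → FluxClass g) :
    HoldsConfig lab x (fluxLabels lab x) := fun j => by simp [fluxLabels]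

theorem computesWithin_entryProg (hG : Fintype.card G < 2 ^ L) (hn : n < 2 ^ L)
    (hm : w.length < 2 ^ L) (x y : Fin n → FluxClass g) :
    ComputesWithin (groupTables lab) entryProg (entryInput lab w x y) (entryTime L w.length n)
      fun q => (q : ℂ) = braidMatrix g w.toBraid y x := by
  classical
  have h1L : 1 < 2 ^ L := lt_of_le_of_lt Fintype.card_pos hG
  have hL0 : L ≠ 0 := by rintro rfl; simp at h1L
  have hs := inputHeld_entryInput (lab := lab) (w := w) x y []
  -- `ComputesWithin` unfolds to `Reach` from the input state without coins.
  refine Reach.seq (P' := .seq testProg (.seq (.assign 0 (.reg 9)) (.assign 1 (.const 1))))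
    ((reach_braidProg hG hn hm hs (holdsConfig_fluxLabels x)).mono le_rfl ?_)
  rintro s₁ ⟨hf₁, -, -, h3, h2⟩
  have h3' : HoldsConfig lab y (s₁.arr 3) := h3.symm ▸ holdsConfig_fluxLabels y
  refine Reach.seq ((reach_testProg hG hn (hs.frame hf₁ (by omega)) h2 h3').mono le_rfl ?_)
  rintro s₂ ⟨-, -, h9⟩
  refine Reach.mono_time (Reach.assign_seq (L := L) (v := if wordAct w x = y then 1 else 0) ?_ <|
    Reach.assign (L := L) (v := 1) ?_ ?_) (by simp only [RExpr.nodes]; omega)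
  · simp only [RExpr.Fits, RExpr.eval, h9]
    split_ifs <;> simp [hL0]
  · simp [RExpr.Fits, RExpr.eval, hL0]
  · rw [braidMatrix_toBraid]
    split_ifs <;> simp [RState.output]

theorem norm_traceClosure_sub_le {ε : ℝ} (hn : 1 ≤ n) (hε : 0 < ε) {q : ℚ}
    (hq : |(q : ℝ) - fluxMean g n fun x => open Classical in if wordAct w x = x then 1 else 0| ≤
      1 / (⌈1 / ε⌉₊ : ℕ)) :
    ‖traceClosure g w.toBraid - (q : ℂ) * (fluxDim g : ℂ) ^ (n - 1)‖ ≤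
      ε * (fluxDim g : ℝ) ^ (n - 1) := by
  have hk : 1 / (⌈1 / ε⌉₊ : ℝ) ≤ ε := (one_div_le
    (Nat.cast_pos.2 (Nat.ceil_pos.2 (one_div_pos.2 hε))) hε).2 (Nat.le_ceil _)
  rw [traceClosure_toBraid w hn, ← sub_mul, norm_mul, norm_pow, Complex.norm_natCast,
    ← Complex.ofReal_ratCast, ← Complex.ofReal_sub, Complex.norm_real, Real.norm_eq_abs,
    abs_sub_comm]
  gcongr
  refine (le_of_eq ?_).trans (hq.trans hk)
  congr!

theorem norm_platClosure_sub_le {l : ℕ} {w : BraidWord (2 * l)} (h : IsConj g g⁻¹) {ε : ℝ}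
    (hε : 0 < ε) {q : ℚ}
    (hq : |(q : ℝ) - fluxMean g (2 * l) fun x => open Classical in
      if mirror h (wordAct w (mirror h x)) = wordAct w (mirror h x) then 1 else 0| ≤
      1 / (⌈1 / ε⌉₊ : ℕ)) :
    ‖platClosure g w.toBraid - (q : ℂ)‖ ≤ ε := by
  have hk : 1 / (⌈1 / ε⌉₊ : ℝ) ≤ ε := (one_div_le
    (Nat.cast_pos.2 (Nat.ceil_pos.2 (one_div_pos.2 hε))) hε).2 (Nat.le_ceil _)
  rw [platClosure_toBraid h, ← Complex.ofReal_ratCast, ← Complex.ofReal_sub, Complex.norm_real,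
    Real.norm_eq_abs, abs_sub_comm]
  refine (le_of_eq ?_).trans (hq.trans hk)
  congr!

end Main

theorem mainTheorem6 :
    -- every braid acts as a permutation matrix
    (∀ (G : Type u) [Group G] [Fintype G] (g : G) (n : ℕ) (b : BraidGroup n),
      ∃ π : Equiv.Perm (Fin n → FluxClass g), braidMatrix g b = π.permMatrix ℂ) ∧
    -- the matrix entries are computable in polynomial time
    (∃ (P : RProg) (p : MvPolynomial (Fin 3) ℕ),
      ∀ (G : Type u) [Group G] [Fintype G] (lab : G ≃ Fin (Fintype.card G)) (g : G)
        (n : ℕ) (w : BraidWord n) (x y : Fin n → FluxClass g),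
        ComputesWithin (groupTables lab) P (entryInput lab w x y)
          (MvPolynomial.eval ![w.length, n, Nat.log 2 (Fintype.card G)] p)
          (fun q => (q : ℂ) = braidMatrix g w.toBraid y x)) ∧
    -- additive approximation of the trace closure, with normalization `d ^ (n - 1)`
    (∃ (P : RProg) (p : MvPolynomial (Fin 4) ℕ),
      ∀ (G : Type u) [Group G] [Fintype G] (lab : G ≃ Fin (Fintype.card G)) (g : G)
        (n : ℕ) (w : BraidWord n) (ε : ℝ), 1 ≤ n → 0 < ε →
        ApproximatesWithin (groupTables lab) P (braidInput lab g w ⌈1 / ε⌉₊)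
          (MvPolynomial.eval ![w.length, n, Nat.log 2 (Fintype.card G), ⌈1 / ε⌉₊] p)
          (fun q => ‖traceClosure g w.toBraid - (q : ℂ) * (fluxDim g : ℂ) ^ (n - 1)‖
            ≤ ε * (fluxDim g : ℝ) ^ (n - 1))) ∧
    -- additive approximation of the plat closure, for a class that is closed under inversion
    (∃ (P : RProg) (p : MvPolynomial (Fin 4) ℕ),
      ∀ (G : Type u) [Group G] [Fintype G] (lab : G ≃ Fin (Fintype.card G)) (g : G)
        (l : ℕ) (w : BraidWord (2 * l)) (ε : ℝ), IsConj g g⁻¹ → 0 < ε →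
        ApproximatesWithin (groupTables lab) P (braidInput lab g w ⌈1 / ε⌉₊)
          (MvPolynomial.eval ![w.length, 2 * l, Nat.log 2 (Fintype.card G), ⌈1 / ε⌉₊] p)
          (fun q => ‖platClosure g w.toBraid - (q : ℂ)‖ ≤ ε)) := by
  refine ⟨fun G _ _ g n b => exists_braidMatrix_eq_permMatrix b,
    ⟨entryProg, entryTime (bitBound (.X 0) (.X 1) (.X 2) 0) (.X 0) (.X 1), ?_⟩,
    ⟨approxProg fixedProg, approxTime (bitBound (.X 0) (.X 1) (.X 2) (.X 3)) (.X 0) (.X 1) (.X 3),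
      ?_⟩,
    ⟨approxProg platProg, approxTime (bitBound (.X 0) (.X 1) (.X 2) (.X 3)) (.X 0) (.X 1) (.X 3),
      ?_⟩⟩
  · intro G _ _ lab g n w x y
    obtain ⟨hG, hn, hm, -⟩ := lt_two_pow_bitBound w.length n (Fintype.card G) 0
    convert computesWithin_entryProg hG hn hm x y using 1
    simp [entryTime, bitBound]
  · intro G _ _ lab g n w ε hn1 hε
    have hk0 : 0 < ⌈1 / ε⌉₊ := Nat.ceil_pos.2 (one_div_pos.2 hε)
    obtain ⟨hG, hn, hm, hk, hQ, -⟩ :=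
      lt_two_pow_bitBound w.length n (Fintype.card G) ⌈1 / ε⌉₊
    refine approximatesWithin_approxProg (decides_fixedProg hG hn hm) hQ hk hk0 hG hn
      ?_ fun q hq => norm_traceClosure_sub_le hn1 hε (by convert hq)
    rw [eval_approxTime]
    simp only [approxTime, trialTime]
    -- `trialTime` is the cost of the longer plat test, so here it is only an upper bound for the
    -- fixed-point test.
    gcongr ?_ + _
    refine Nat.mul_le_mul_left _ ?_
    omega
  · intro G _ _ lab g l w ε hinv hε
    have hk0 : 0 < ⌈1 / ε⌉₊ := Nat.ceil_pos.2 (one_div_pos.2 hε)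
    obtain ⟨hG, hn, hm, hk, hQ, h2⟩ :=
      lt_two_pow_bitBound w.length (2 * l) (Fintype.card G) ⌈1 / ε⌉₊
    refine approximatesWithin_approxProg (decides_platProg hG hn hm h2 hinv) hQ hk hk0 hG hn
      ?_ fun q hq => norm_platClosure_sub_le hinv hε (by convert hq)
    rw [eval_approxTime]
    rfl
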